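/- Let $S$ be a finite non-empty set and let $p:2^S\to\mathbb Z\cup\{-\infty\}$ be supermodular, i.e. $p(X)+p(Y)\le p(X\cap Y)+p(X\cup Y)$ for all $X,Y\subseteq S$, with $p(\emptyset)=0$ and $p(S)$ finite. Let $B=\{x\in\mathbb R^S: x(S)=p(S),\ x(Z)\ge p(Z)\ \forall Z\subseteq S\}$, where $x(Z)=\sum_{s\in Z}x(s)$. For $\pi\in\mathbb Z^S$, index $S=\{s_1,\dots,s_n\}$ so that $\pi(s_1)\ge\dots\ge\pi(s_n)$, let $I_j=\{s_1,\dots,s_j\}$, and put $\hat p(\pi)=p(I_n)\pi(s_n)+\sum_{j=1}^{n-1}p(I_j)\,[\pi(s_j)-\pi(s_{j+1})]$ (with $-\infty\cdot 0=0$). Let $\Pi$ be the set of optimal dual integral vectors, that is, the maximizers $\pi\in\mathbb Z^S$ on the right-hand side of $$\min\Big\{\sum_{s\in S} m(s)^2: m\in B\cap\mathbb Z^S\Big\}=\max\Big\{\hat p(\pi)-\sum_{s\in S}\Big\lfloor\frac{\pi(s)}2\Big\rfloor\Big\lceil\frac{\pi(s)}2\Big\rceil:\pi\in\mathbb Z^S\Big\}.$$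 The canonical partition $S_1,\dots,S_q$ and the essential value-sequence $\beta_1,\dots,\beta_q$ are defined iteratively. Put $C_0=\emptyset$. As long as $C_{i-1}\ne S$, let $\beta_i=\max\{\lceil (p(X\cup C_{i-1})-p(C_{i-1}))/|X|\rceil:\emptyset\ne X\subseteq S-C_{i-1}\}$, let $S_i$ be the smallest subset of $S-C_{i-1}$ maximizing $h_i(X)=p(X\cup C_{i-1})-p(C_{i-1})-(\beta_i-1)|X|$ over $X\subseteq S-C_{i-1}$, and put $C_i=C_{i-1}\cup S_i$; $q$ is the index with $C_q=S$. Let $p_i(X)=p(X\cup C_{i-1})-p(C_{i-1})$ for $X\subseteq S_i$, let $\mathcal F_i=\{X\subseteq S_i:\beta_i|X|=p_i(X)\}$, and let $F_i$ be the union of the members of $\mathcal F_i$. Let $D_i=(F_i,A_i)$ be the digraph in which $st$ (for distinct $s,t\in F_i$) is an arc if no member of $\mathcal F_i$ contains $t$ but not $s$. An element $m$ of $B\cap\mathbb Z^S$ is decreasingly minimal if its components, arranged in decreasing order, form the lexicographically smallest sequence obtained in this way from the elements of $B\cap\mathbb Z^S$. An element $s\in S$ is value-fixed if $m(s)$ is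 the same for every decreasingly minimal $m$. Then the following hold. 1. The sets $S_1,\dots,S_q$ are non-empty and form a partition of $S$, and $\beta_1>\dots>\beta_q$. 2. For each $i$, $F_i$ is the set of the value-fixed elements of $S_i$. 3. A vector $\pi\in\mathbb Z^S$ belongs to $\Pi$ if and only if, for each $i=1,\dots,q$: $\pi(s)=2\beta_i-1$ for every $s\in S_i-F_i$; $2\beta_i-1\le\pi(s)\le2\beta_i+1$ for every $s\in F_i$; and $\pi(s)\ge\pi(t)$ for every arc $st\in A_i$. 4. $\Pi$ is an L$^\natural$-convex set: it is non-empty and has the form $\{\pi\in\mathbb Z^S: \ell(s)\le\pi(s)\le u(s),\ \pi(t)-\pi(s)\le g(s,t)\ \text{for all } s,t\in S\}$ with $\ell(s)\in\mathbb Z\cup\{-\infty\}$ and $u(s),g(s,t)\in\mathbb Z\cup\{+\infty\}$. 5. The unique smallest element of $\Pi$ (with respect to the componentwise order) is $\pi^*$, where $\pi^*(s)=2\beta_i-1$ for $s\in S_i$ $(i=1,\dots,q)$. -/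

import Mathlib

/-! ### Integer-valued supermodular set-functions (the value `-∞`, written `⊥`, is allowed) -/

/-- `p` is a (fully) supermodular set-function with `p(∅) = 0` and `p(S)` finite. With the convention
`⊥ + a = ⊥`, the inequality only says something about pairs `X, Y` with finite `p`-values. -/
structure IsSupermodular {S : Type*} [Fintype S] [DecidableEq S]
    (p : Finset S → WithBot ℤ) : Prop where
  empty : p ∅ = 0
  univ_ne_bot : p Finset.univ ≠ ⊥
  supermodular : ∀ X Y : Finset S, p X + p Y ≤ p (X ∩ Y) + p (X ∪ Y)

/-- The set of integral members of the base-polyhedron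
`B'(p) = {x : x(S) = p(S), x(Z) ≥ p(Z) for all Z}`. -/
def intBase {S : Type*} [Fintype S] (p : Finset S → WithBot ℤ) : Set (S → ℤ) :=
  {m | ((∑ s, m s : ℤ) : WithBot ℤ) = p Finset.univ ∧
    ∀ Z : Finset S, p Z ≤ ((∑ s ∈ Z, m s : ℤ) : WithBot ℤ)}

/-! ### Decreasing minimality and value-fixed elements -/

/-- The components of `x` rearranged in a (weakly) decreasing order. -/
noncomputable def decList {S : Type*} [Fintype S] (x : S → ℤ) : List ℤ :=
  (Finset.univ.val.map x).sort (· ≥ ·)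

/-- The dec-min elements of a set `Q` of integral vectors: those `x ∈ Q` whose decreasing
rearrangement is lexicographically smallest. -/
def decMin {S : Type*} [Fintype S] (Q : Set (S → ℤ)) : Set (S → ℤ) :=
  {x | x ∈ Q ∧ ∀ y ∈ Q, decList x ≤ decList y}

/-- `s` is value-fixed if `m s` is the same for every dec-min element `m` of the integral members
of `B'(p)`. -/
def IsValueFixed {S : Type*} [Fintype S] (p : Finset S → WithBot ℤ) (s : S) : Prop :=
  ∀ m ∈ decMin (intBase p), ∀ m' ∈ decMin (intBase p), m s = m' s

/-! ### Canonical chain, canonical partition, essential value-sequence -/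

/-- The contraction `(p / Z)(X) = p(X ∪ Z) - p(Z)` (used for `X` disjoint from `Z` and `p(Z)`
finite). -/
def contractFn {S : Type*} [DecidableEq S] (p : Finset S → WithBot ℤ) (Z X : Finset S) :
    WithBot ℤ :=
  (p (X ∪ Z)).map (fun a => a - (p Z).unbotD 0)

/-- `max {⌈(p(X ∪ C) - p(C)) / |X|⌉ : ∅ ≠ X ⊆ S - C}`, for `C ≠ S`
(sets `X` for which `p(X ∪ C) = -∞` contribute `-∞`). -/
def betaAt {S : Type*} [Fintype S] [DecidableEq S] (p : Finset S → WithBot ℤ) (C : Finset S) : ℤ :=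
  ((Cᶜ.powerset.filter (fun X => X.Nonempty)).sup
    (fun X => (contractFn p C X).map (fun a : ℤ => ⌈(a : ℚ) / (X.card : ℚ)⌉))).unbotD 0

/-- `h(X) = (p / C)(X) - (β - 1) |X|`, where `β = betaAt p C`. -/
def hAt {S : Type*} [Fintype S] [DecidableEq S] (p : Finset S → WithBot ℤ) (C X : Finset S) :
    WithBot ℤ :=
  (contractFn p C X).map (fun a => a - (betaAt p C - 1) * (X.card : ℤ))

/-- The peak-set of `S - C` with respect to `p / C`: the intersection of all subsets of `S - C`
maximizing `hAt p C` over the subsets of `S - C`. -/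
def peakAt {S : Type*} [Fintype S] [DecidableEq S] (p : Finset S → WithBot ℤ) (C : Finset S) :
    Finset S :=
  Cᶜ.filter (fun s => ∀ X ∈ Cᶜ.powerset, (∀ Y ∈ Cᶜ.powerset, hAt p C Y ≤ hAt p C X) → s ∈ X)

/-- The canonical chain `C₀ = ∅ ⊂ C₁ ⊂ C₂ ⊂ ⋯`: the next member is obtained by adding the
peak-set of the complement (and the chain is constant once it reaches `S`). -/
def canonChain {S : Type*} [Fintype S] [DecidableEq S] (p : Finset S → WithBot ℤ) : ℕ → Finset S
  | 0 => ∅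
  | i + 1 => canonChain p i ∪ peakAt p (canonChain p i)

/-- The number `q` of the parts: the iterative procedure stops when the chain reaches `S`. -/
noncomputable def numParts {S : Type*} [Fintype S] [DecidableEq S]
    (p : Finset S → WithBot ℤ) : ℕ :=
  sInf {i | canonChain p i = Finset.univ}

/-- The `i`-th part of the canonical partition, `0 ≤ i < q` (parts are numbered from `0`). -/
def canonPart {S : Type*} [Fintype S] [DecidableEq S] (p : Finset S → WithBot ℤ) (i : ℕ) : Finset S :=
  peakAt p (canonChain p i)

/-- The `i`-th member of the essential value-sequence, `0 ≤ i < q`. -/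
def essValue {S : Type*} [Fintype S] [DecidableEq S] (p : Finset S → WithBot ℤ) (i : ℕ) : ℤ :=
  betaAt p (canonChain p i)

/-! ### The sets `F_i` and the digraphs `D_i` -/

/-- The family of the subsets `X` of the `i`-th part `S_i` with `β_i |X| = p_i(X)`, where
`p_i(X) = p(X ∪ C) - p(C)` and `C` is the union of the preceding parts. -/
def tightFamily {S : Type*} [Fintype S] [DecidableEq S] (p : Finset S → WithBot ℤ) (i : ℕ) :
    Finset (Finset S) :=
  (canonPart p i).powerset.filter
    (fun X => contractFn p (canonChain p i) X = ((essValue p i * (X.card : ℤ) : ℤ) : WithBot ℤ))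

/-- `F_i`: the union of the members of `tightFamily p i`. -/
def fixedPart {S : Type*} [Fintype S] [DecidableEq S] (p : Finset S → WithBot ℤ) (i : ℕ) :
    Finset S :=
  (tightFamily p i).biUnion id

/-- The arcs of the (loopless) digraph `D_i` on `F_i`: `st` is an arc if no member of
`tightFamily p i` contains `t` but not `s`. -/
def IsArc {S : Type*} [Fintype S] [DecidableEq S] (p : Finset S → WithBot ℤ) (i : ℕ)
    (s t : S) : Prop :=
  s ∈ fixedPart p i ∧ t ∈ fixedPart p i ∧ s ≠ t ∧ ¬ ∃ X ∈ tightFamily p i, t ∈ X ∧ s ∉ X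

/-! ### The dual problem -/

/-- An indexing `s_1, …, s_n` of the elements of `S` along which `π` is decreasing. -/
noncomputable def sortedIndexing {S : Type*} [Fintype S] (π : S → ℤ) :
    Fin (Fintype.card S) ≃ S :=
  (Tuple.sort (fun i => - π ((Fintype.equivFin S).symm i))).trans (Fintype.equivFin S).symm

theorem antitone_sortedIndexing {S : Type*} [Fintype S] (π : S → ℤ) :
    Antitone (fun i => π (sortedIndexing π i)) := by
  intro i j hij
  have h := Tuple.monotone_sort (fun i => - π ((Fintype.equivFin S).symm i)) hij
  simpa [sortedIndexing] using h

/-- The linear (Lovász) extension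
`p(I_n) π(s_n) + ∑_{j < n} p(I_j) (π(s_j) - π(s_{j+1}))` with `I_j = {s_1, …, s_j}` and
`π(s_1) ≥ ⋯ ≥ π(s_n)`; the product in `WithBot ℤ` satisfies `⊥ * 0 = 0`, and `⊥ * a = ⊥` for
`a > 0`. The summand for the last index is `p(I_n) π(s_n)`. -/
noncomputable def linExt {S : Type*} [Fintype S] [DecidableEq S] (p : Finset S → WithBot ℤ)
    (π : S → ℤ) : WithBot ℤ :=
  ∑ j : Fin (Fintype.card S),
    p ((Finset.Iic j).image (sortedIndexing π)) *
      (((if h : (j : ℕ) + 1 < Fintype.card S then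
          π (sortedIndexing π j) - π (sortedIndexing π ⟨(j : ℕ) + 1, h⟩)
        else π (sortedIndexing π j)) : ℤ) : WithBot ℤ)

/-- The objective function `p̂(π) - ∑ ⌊π(s)/2⌋ ⌈π(s)/2⌉` of the dual side of
`min {∑ m(s)² : m ∈ B'(p) integral} = max {p̂(π) - ∑ ⌊π(s)/2⌋ ⌈π(s)/2⌉ : π ∈ ℤ^S}`. -/
noncomputable def dualObjective {S : Type*} [Fintype S] [DecidableEq S]
    (p : Finset S → WithBot ℤ) (π : S → ℤ) : WithBot ℤ :=
  (linExt p π).map (fun a => a - ∑ s, ⌊(π s : ℚ) / 2⌋ * ⌈(π s : ℚ) / 2⌉)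

/-- The set `Π` of the optimal dual integral vectors. -/
def dualOptima {S : Type*} [Fintype S] [DecidableEq S] (p : Finset S → WithBot ℤ) :
    Set (S → ℤ) :=
  {π | ∀ π' : S → ℤ, dualObjective p π' ≤ dualObjective p π}

/-! ### L♮-convex sets -/

/-- A set of integral vectors is L♮-convex if it is non-empty and is the set of the integer-valued
feasible potentials in a box (bounds may be infinite). -/
def IsLNatConvex {S : Type*} (L : Set (S → ℤ)) : Prop :=
  L.Nonempty ∧ ∃ (lo : S → WithBot ℤ) (hi : S → WithTop ℤ) (g : S → S → WithTop ℤ),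
    L = {π | (∀ s, lo s ≤ (π s : WithBot ℤ) ∧ (π s : WithTop ℤ) ≤ hi s) ∧
      ∀ u v, ((π v - π u : ℤ) : WithTop ℤ) ≤ g u v}

/-! Write `C_i` for `canonChain p i`, the union of the parts preceding `S_i` (counting from `0`).
For a base `m` and an integer level `k`, the supermodular function `tilt p k`, `p(X) - k|X|`, is
bounded by the excess `∑ (m(s) - k)⁺`, with equality iff `X` is tight and `{m > k} ⊆ X ⊆ {m ≥ k}`
(`tilt_eq_excess_iff`). A base of least square-sum attains equality at every level
(`exists_isLeastMajorized`), and the bases that do so are exactly the dec-min ones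
(`mem_decMin_iff`).

The canonical chain consists of tilt maximizers: `C_i` at level `β_i`, `C_{i+1}` at level `β_i - 1`
(`tilt_essValue_le`, `tilt_essValue_sub_one_le`). So every dec-min `m` takes only the values `β_i -
1` and `β_i` on `S_i`. It equals `β_i` on `F_i`, and exchanges show that both values occur at every
other element of `S_i`.

Weak duality combines Abel summation of the linear extension with an integer inequality in each
coordinate. Equality for `π` and `m` means that all upper level sets of `π` are `m`-tight and `|π -
2m| ≤ 1` (`dualObjective_le_and_eq_iff`). The vector `2β_i - 1` satisfies this, so `π` is optimal
iff it satisfies it with dec-min bases; the two-value structure turns this into bounds and arc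
conditions (`mem_dualOptima_iff`). -/

namespace SupermodularDual

/-! ### Tight sets, existence of integral bases, and exchanges -/

section Tight

variable {S : Type*} {p : Finset S → WithBot ℤ} {m : S → ℤ}

/-- `Z` is `m`-tight if `m` attains the lower bound `p Z` on `Z`. -/
def IsTight (p : Finset S → WithBot ℤ) (m : S → ℤ) (Z : Finset S) : Prop :=
  p Z = ((∑ s ∈ Z, m s : ℤ) : WithBot ℤ)

theorem isTight_univ [Fintype S] (hm : m ∈ intBase p) : IsTight p m Finset.univ := hm.1.symm

variable [Fintype S] [DecidableEq S]

theorem IsTight.inter_union (hp : IsSupermodular p)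
    (hm : ∀ Z : Finset S, p Z ≤ ((∑ s ∈ Z, m s : ℤ) : WithBot ℤ)) {X Y : Finset S}
    (hX : IsTight p m X) (hY : IsTight p m Y) :
    IsTight p m (X ∩ Y) ∧ IsTight p m (X ∪ Y) := by
  have h := hp.supermodular X Y
  have h1 := hm (X ∩ Y)
  have h2 := hm (X ∪ Y)
  have h3 := Finset.sum_union_inter (s₁ := X) (s₂ := Y) (f := m)
  unfold IsTight at *
  rw [hX, hY] at h
  generalize p (X ∩ Y) = a at *
  generalize p (X ∪ Y) = b at *
  cases a using WithBot.recBotCoe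
  · rw [WithBot.bot_add, le_bot_iff, ← WithBot.coe_add] at h
    exact absurd h WithBot.coe_ne_bot
  cases b using WithBot.recBotCoe
  · rw [WithBot.add_bot, le_bot_iff, ← WithBot.coe_add] at h
    exact absurd h WithBot.coe_ne_bot
  rw [← WithBot.coe_add, ← WithBot.coe_add, WithBot.coe_le_coe] at h
  rw [WithBot.coe_le_coe] at h1 h2
  rw [WithBot.coe_inj, WithBot.coe_inj]
  omega

theorem isTight_empty (hp : IsSupermodular p) : IsTight p m ∅ := by
  simp [IsTight, hp.empty]

theorem IsTight.inter (hp : IsSupermodular p) (hm : m ∈ intBase p) {X Y : Finset S}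
    (hX : IsTight p m X) (hY : IsTight p m Y) : IsTight p m (X ∩ Y) :=
  (hX.inter_union hp hm.2 hY).1

theorem IsTight.union (hp : IsSupermodular p) (hm : m ∈ intBase p) {X Y : Finset S}
    (hX : IsTight p m X) (hY : IsTight p m Y) : IsTight p m (X ∪ Y) :=
  (hX.inter_union hp hm.2 hY).2

/-- If any element of `A` can be separated from any element of `D` by a tight set, then a single
tight set separates `A` from `D`. -/
theorem exists_isTight_separating (hp : IsSupermodular p) (hm : m ∈ intBase p) (A D : Finset S)
    (h : ∀ t ∈ A, ∀ s ∈ D, ∃ Z, IsTight p m Z ∧ t ∈ Z ∧ s ∉ Z) :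
    ∃ Z, IsTight p m Z ∧ (∀ t ∈ A, t ∈ Z) ∧ ∀ s ∈ D, s ∉ Z := by
  -- Tight sets form a lattice: for fixed `t` intersect over `D`, then take the union over `A`.
  have key : ∀ t ∈ A, ∃ Z, IsTight p m Z ∧ t ∈ Z ∧ ∀ s ∈ D, s ∉ Z := by
    intro t ht
    have h' := h t ht
    clear h
    induction D using Finset.induction_on with
    | empty => exact ⟨Finset.univ, isTight_univ hm, Finset.mem_univ _, by simp⟩
    | insert s D _ ih =>
      obtain ⟨Z, hZ, htZ, hsZ⟩ := ih fun s hs => h' s (Finset.mem_insert_of_mem hs)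
      obtain ⟨W, hW, htW, hsW⟩ := h' s (Finset.mem_insert_self _ _)
      refine ⟨Z ∩ W, hZ.inter hp hm hW, Finset.mem_inter.2 ⟨htZ, htW⟩, ?_⟩
      intro x hx hxZ
      rw [Finset.mem_inter] at hxZ
      rcases Finset.mem_insert.1 hx with rfl | hx
      · exact hsW hxZ.2
      · exact hsZ x hx hxZ.1
  clear h
  induction A using Finset.induction_on with
  | empty => exact ⟨∅, isTight_empty hp, by simp, by simp⟩
  | insert t A _ ih =>
    obtain ⟨Z, hZ, htZ, hsZ⟩ := ih fun s hs => key s (Finset.mem_insert_of_mem hs)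
    obtain ⟨W, hW, htW, hsW⟩ := key t (Finset.mem_insert_self _ _)
    refine ⟨Z ∪ W, hZ.union hp hm hW, ?_, ?_⟩
    · intro x hx
      rcases Finset.mem_insert.1 hx with rfl | hx
      · exact Finset.mem_union_right _ htW
      · exact Finset.mem_union_left _ (htZ x hx)
    · intro x hx hxZ
      rcases Finset.mem_union.1 hxZ with hxZ | hxZ
      · exact hsZ x hx hxZ
      · exact hsW x hx hxZ

/-- Take a vector of least total among those satisfying all lower bounds. Each element lies in a
tight set, since otherwise its component could drop by one; the union of these sets shows that `S`
is tight. -/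
theorem intBase_nonempty (hp : IsSupermodular p) : (intBase p).Nonempty := by
  obtain ⟨c, hc⟩ := WithBot.ne_bot_iff_exists.1 hp.univ_ne_bot
  let Q : Set (S → ℤ) := {x | ∀ Z : Finset S, p Z ≤ ((∑ s ∈ Z, x s : ℤ) : WithBot ℤ)}
  have hQ : Q.Nonempty := by
    -- The constant vector `N` meets every lower bound, because a non-empty `Z` receives at least
    -- `N`.
    obtain ⟨N, hN⟩ : ∃ N : ℕ, ∀ Z : Finset S, (p Z).unbotD 0 ≤ N := by
      refine ⟨∑ Z : Finset S, ((p Z).unbotD 0).toNat, fun Z => ?_⟩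
      have := Finset.single_le_sum (f := fun Z => ((p Z).unbotD 0).toNat)
        (fun _ _ => Nat.zero_le _) (Finset.mem_univ Z)
      have h2 := Int.self_le_toNat ((p Z).unbotD 0)
      exact h2.trans (by exact_mod_cast this)
    refine ⟨fun _ => N, fun Z => ?_⟩
    rcases Z.eq_empty_or_nonempty with rfl | hZ
    · simp [hp.empty]
    · have h1 := hN Z
      cases hpz : p Z using WithBot.recBotCoe with
      | bot => exact bot_le
      | coe a =>
        rw [hpz, WithBot.unbotD_coe] at h1
        rw [WithBot.coe_le_coe, Finset.sum_const, nsmul_eq_mul]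
        have h2 : (1 : ℤ) ≤ Z.card := by exact_mod_cast hZ.card_pos
        nlinarith
  have hlow : ∀ x ∈ Q, c ≤ ∑ s, x s := fun x hx => by
    have := hx Finset.univ
    rwa [← hc, WithBot.coe_le_coe] at this
  obtain ⟨x, hx, hmin⟩ := exists_minimalFor_of_wellFoundedLT (· ∈ Q)
    (fun x => (∑ s, x s - c).toNat) hQ
  refine ⟨x, ?_, hx⟩
  have hcov : ∀ s : S, ∃ Z, IsTight p x Z ∧ s ∈ Z := by
    intro s
    by_contra! hs
    have hx' : (fun t => x t - if t = s then 1 else 0) ∈ Q := by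
      intro Z
      rw [Finset.sum_sub_distrib, Finset.sum_ite_eq']
      split_ifs with hsZ
      · have h1 := hx Z
        have h2 : p Z ≠ _ := fun h => hs Z h hsZ
        generalize p Z = a at *
        cases a using WithBot.recBotCoe
        · exact bot_le
        · rw [WithBot.coe_le_coe] at h1 ⊢
          rw [Ne, WithBot.coe_inj] at h2
          omega
      · simpa using hx Z
    have h1 := hmin hx'
    have h2 := hlow _ hx
    have h3 := hlow _ hx'
    simp only [Finset.sum_sub_distrib, Finset.sum_ite_eq', Finset.mem_univ, if_true] at h1 h3
    omega
  have : ∀ A : Finset S, ∃ Z, IsTight p x Z ∧ A ⊆ Z := by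
    intro A
    induction A using Finset.induction_on with
    | empty => exact ⟨∅, isTight_empty hp, by simp⟩
    | insert t A _ ih =>
      obtain ⟨Z, hZ, hAZ⟩ := ih
      obtain ⟨W, hW, htW⟩ := hcov t
      refine ⟨Z ∪ W, (hZ.inter_union hp hx hW).2, Finset.insert_subset
        (Finset.mem_union_right _ htW) (hAZ.trans Finset.subset_union_left)⟩
  obtain ⟨Z, hZ, hAZ⟩ := this Finset.univ
  rw [Finset.univ_subset_iff] at hAZ
  subst hAZ
  exact hZ.symm

/-- Exchange: one unit can be moved from `t` to `s` if no tight set separates `t` from `s`. -/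
theorem exchange_mem_intBase (hm : m ∈ intBase p) {s t : S}
    (h : ∀ Z, IsTight p m Z → t ∈ Z → s ∈ Z) :
    (fun x => m x + (if x = s then 1 else 0) - (if x = t then 1 else 0)) ∈ intBase p := by
  have hsum : ∀ Z : Finset S,
      ∑ x ∈ Z, (m x + (if x = s then 1 else 0) - (if x = t then 1 else 0)) =
        ∑ x ∈ Z, m x + (if s ∈ Z then 1 else 0) - (if t ∈ Z then 1 else 0) := by
    intro Z
    rw [Finset.sum_sub_distrib, Finset.sum_add_distrib, Finset.sum_ite_eq', Finset.sum_ite_eq']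
  constructor
  · rw [hsum]
    simpa using hm.1
  · intro Z
    rw [hsum]
    have h1 := hm.2 Z
    have h2 := h Z
    unfold IsTight at h2
    generalize p Z = a at *
    cases a using WithBot.recBotCoe
    · exact bot_le
    · rw [WithBot.coe_le_coe] at h1 ⊢
      rw [WithBot.coe_inj] at h2
      split_ifs with hs ht
      · omega
      · omega
      · have : ¬ _ := fun h => hs (h2 h ‹_›)
        omega
      · omega

end Tight

/-! ### Excess over a level, and dec-min bases as least majorized ones -/

section Excess

variable {S : Type*} {p : Finset S → WithBot ℤ} {m : S → ℤ}

/-- `p(X) - k |X|`. -/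
def tilt (p : Finset S → WithBot ℤ) (k : ℤ) (X : Finset S) : WithBot ℤ :=
  p X + ((-(k * X.card) : ℤ) : WithBot ℤ)

theorem tilt_le_tilt_iff {k : ℤ} {X Y : Finset S} {b : ℤ} (hY : p Y = b) :
    tilt p k X ≤ tilt p k Y ↔ ∀ a : ℤ, p X = a → a - k * X.card ≤ b - k * Y.card := by
  unfold tilt
  rw [hY]
  cases p X using WithBot.recBotCoe with
  | bot => simp
  | coe a =>
    rw [← WithBot.coe_add, ← WithBot.coe_add, WithBot.coe_le_coe]
    constructor
    · intro h a' ha'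
      rw [WithBot.coe_inj] at ha'
      omega
    · intro h
      have := h a rfl
      omega

/-- Lowering the level favours larger sets, raising it favours smaller ones. -/
theorem tilt_le_tilt_of_le {k k' : ℤ} {X Y : Finset S} (hY : p Y ≠ ⊥)
    (h : tilt p k X ≤ tilt p k Y) (hk : (k' - k) * Y.card ≤ (k' - k) * X.card) :
    tilt p k' X ≤ tilt p k' Y := by
  obtain ⟨b, hb⟩ := WithBot.ne_bot_iff_exists.1 hY
  rw [tilt_le_tilt_iff hb.symm] at h ⊢
  intro a ha
  have := h a ha
  linarith

/-- `∑ (m(s) - k)⁺`. -/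
def excess [Fintype S] (m : S → ℤ) (k : ℤ) : ℤ := ∑ s, max (m s - k) 0

theorem excess_eq_sum_decList [Fintype S] (m : S → ℤ) (k : ℤ) :
    excess m k = ((decList m).map fun a => max (a - k) 0).sum := by
  rw [← Multiset.sum_coe, ← Multiset.map_coe, decList, Multiset.sort_eq, Multiset.map_map]
  rfl

theorem excess_term_nonneg [DecidableEq S] (m : S → ℤ) (k : ℤ) (X : Finset S) (s : S) :
    0 ≤ max (m s - k) 0 - if s ∈ X then m s - k else 0 := by
  split_ifs <;> omega

variable [Fintype S] [DecidableEq S]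

theorem excess_eq (m : S → ℤ) (k : ℤ) (X : Finset S) :
    excess m k = ∑ s ∈ X, m s - k * X.card +
      ∑ s, (max (m s - k) 0 - if s ∈ X then m s - k else 0) := by
  rw [Finset.sum_sub_distrib, Finset.sum_ite_mem, Finset.univ_inter, Finset.sum_sub_distrib,
    Finset.sum_const, nsmul_eq_mul, excess]
  ring

theorem tilt_le_excess (hm : m ∈ intBase p) (k : ℤ) (X : Finset S) :
    tilt p k X ≤ (excess m k : WithBot ℤ) := by
  have h1 := hm.2 X
  have h2 := Finset.sum_nonneg fun s (_ : s ∈ Finset.univ) => excess_term_nonneg m k X s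
  rw [excess_eq m k X]
  unfold tilt
  generalize p X = a at *
  cases a using WithBot.recBotCoe
  · simp
  · rw [WithBot.coe_le_coe] at h1
    rw [← WithBot.coe_add, WithBot.coe_le_coe]
    omega

/-- Equality must hold in both `p(X) ≤ m(X)` and `m(X) - k|X| ≤ ∑ (m(s) - k)⁺`; the second is
checked termwise through `excess_eq`. -/
theorem tilt_eq_excess_iff (hm : m ∈ intBase p) (k : ℤ) (X : Finset S) :
    tilt p k X = (excess m k : WithBot ℤ) ↔
      IsTight p m X ∧ (∀ s ∈ X, k ≤ m s) ∧ ∀ s ∉ X, m s ≤ k := by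
  have h1 := hm.2 X
  have h2 := Finset.sum_nonneg fun s (_ : s ∈ Finset.univ) => excess_term_nonneg m k X s
  have h3 := Finset.sum_eq_zero_iff_of_nonneg
    fun s (_ : s ∈ Finset.univ) => excess_term_nonneg m k X s
  have h4 : (∀ s ∈ Finset.univ, (max (m s - k) 0 - if s ∈ X then m s - k else 0) = 0) ↔
      (∀ s ∈ X, k ≤ m s) ∧ ∀ s ∉ X, m s ≤ k := by
    constructor
    · intro h
      refine ⟨fun s hs => ?_, fun s hs => ?_⟩
      · have := h s (Finset.mem_univ _)
        rw [if_pos hs] at this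
        omega
      · have := h s (Finset.mem_univ _)
        rw [if_neg hs] at this
        omega
    · rintro ⟨h, h'⟩ s -
      split_ifs with hs
      · have := h s hs
        omega
      · have := h' s hs
        omega
  rw [← h4, ← h3, excess_eq m k X]
  unfold tilt IsTight
  generalize p X = a at *
  cases a using WithBot.recBotCoe
  · rw [WithBot.bot_add]
    exact ⟨fun h => absurd h.symm WithBot.coe_ne_bot, fun h => absurd h.1.symm WithBot.coe_ne_bot⟩
  · rw [WithBot.coe_le_coe] at h1
    rw [← WithBot.coe_add, WithBot.coe_inj, WithBot.coe_inj]
    omega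

theorem isTight_of_tilt_max {k : ℤ} {Z C : Finset S} (hm : m ∈ intBase p)
    (hZ : tilt p k Z = (excess m k : WithBot ℤ)) (hC : ∀ X, tilt p k X ≤ tilt p k C) :
    IsTight p m C ∧ (∀ s ∈ C, k ≤ m s) ∧ ∀ s ∉ C, m s ≤ k :=
  (tilt_eq_excess_iff hm k C).1 (le_antisymm (tilt_le_excess hm k C) (hZ ▸ hC Z))

/-- `m` is a member of the base-polyhedron whose excess over any level is attained by a set. -/
def IsLeastMajorized (p : Finset S → WithBot ℤ) (m : S → ℤ) : Prop :=
  m ∈ intBase p ∧ ∀ k : ℤ, ∃ Z, tilt p k Z = (excess m k : WithBot ℤ)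

theorem IsLeastMajorized.excess_le {m' : S → ℤ} (hm : IsLeastMajorized p m)
    (hm' : m' ∈ intBase p) (k : ℤ) : excess m k ≤ excess m' k := by
  obtain ⟨Z, hZ⟩ := hm.2 k
  have := tilt_le_excess hm' k Z
  rwa [hZ, WithBot.coe_le_coe] at this

/-- If `m t > k > m s`, moving a unit from `t` to `s` lowers the sum of squares. For a minimizer
this is therefore blocked by a tight set, and one tight set separating `{m > k}` from `{m < k}`
attains the excess. -/
theorem exists_isLeastMajorized (hp : IsSupermodular p) : ∃ m, IsLeastMajorized p m := by
  obtain ⟨m, hm, hmin⟩ := exists_minimalFor_of_wellFoundedLT (· ∈ intBase p)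
    (fun x => (∑ s, x s ^ 2).toNat) (intBase_nonempty hp)
  refine ⟨m, hm, fun k => ?_⟩
  obtain ⟨Z, hZ, h1, h2⟩ := exists_isTight_separating hp hm
    (Finset.univ.filter fun t => k < m t) (Finset.univ.filter fun s => m s < k) (by
      intro t ht s hs
      rw [Finset.mem_filter] at ht hs
      by_contra! hcon
      have hx := exchange_mem_intBase hm hcon
      have h1 := hmin hx
      have hst : s ≠ t := by
        rintro rfl
        omega
      have h2 : ∑ x, (m x + (if x = s then 1 else 0) - (if x = t then 1 else 0)) ^ 2 =
          ∑ x, m x ^ 2 + (2 * m s + 1) + (1 - 2 * m t) := by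
        have : ∀ x, (m x + (if x = s then 1 else 0) - (if x = t then 1 else 0)) ^ 2 =
            m x ^ 2 + (if x = s then 2 * m x + 1 else 0) + (if x = t then 1 - 2 * m x else 0) := by
          intro x
          split_ifs with h h'
          · exact absurd (h.symm.trans h') hst
          all_goals ring
        simp_rw [this]
        rw [Finset.sum_add_distrib, Finset.sum_add_distrib, Finset.sum_ite_eq',
          Finset.sum_ite_eq', if_pos (Finset.mem_univ _), if_pos (Finset.mem_univ _)]
      have h3 : 0 ≤ ∑ x, (m x + (if x = s then 1 else 0) - (if x = t then 1 else 0)) ^ 2 :=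
        Finset.sum_nonneg fun _ _ => sq_nonneg _
      simp only [h2] at h1 h3
      omega)
  refine ⟨Z, (tilt_eq_excess_iff hm k Z).2 ⟨hZ, fun s hs => ?_, fun s hs => ?_⟩⟩
  · by_contra! h
    exact h2 s (by simpa using h) hs
  · by_contra! h
    exact hs (h1 s (by simpa using h))

theorem sum_excess_nonneg (k : ℤ) (l : List ℤ) : 0 ≤ (l.map fun a => max (a - k) 0).sum := by
  refine List.sum_nonneg fun x hx => ?_
  obtain ⟨a, -, rfl⟩ := List.mem_map.1 hx
  exact le_max_right _ _

/-- A lexicographic inequality of decreasing sequences is witnessed by the excess over a level. -/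
theorem exists_sum_excess_lt_of_lex {l₁ l₂ : List ℤ} (h₁ : l₁.Pairwise (· ≥ ·))
    (h : List.Lex (· < ·) l₁ l₂) :
    ∃ k, (l₁.map fun a => max (a - k) 0).sum < (l₂.map fun a => max (a - k) 0).sum := by
  induction h with
  | nil =>
    rename_i b l
    refine ⟨b - 1, ?_⟩
    have := sum_excess_nonneg (b - 1) l
    simp only [List.map_nil, List.sum_nil, List.map_cons, List.sum_cons]
    omega
  | rel hab =>
    rename_i a l b l'
    -- As `l₁` is decreasing, none of its entries exceeds its head `a`, while `l₂` starts above `a`.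
    refine ⟨a, ?_⟩
    have h0 := sum_excess_nonneg a l'
    have h1 : (l.map fun x => max (x - a) 0).sum = 0 := by
      refine List.sum_eq_zero fun x hx => ?_
      obtain ⟨y, hy, rfl⟩ := List.mem_map.1 hx
      have := List.rel_of_pairwise_cons h₁ hy
      omega
    simp only [List.map_cons, List.sum_cons]
    omega
  | cons _ ih =>
    obtain ⟨k, hk⟩ := ih h₁.of_cons
    exact ⟨k, by simpa using hk⟩

theorem IsLeastMajorized.mem_decMin (hm : IsLeastMajorized p m) : m ∈ decMin (intBase p) := by
  refine ⟨hm.1, fun y hy => ?_⟩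
  by_contra hlt
  rw [not_le] at hlt
  obtain ⟨k, hk⟩ := exists_sum_excess_lt_of_lex (Multiset.pairwise_sort _ _) hlt
  change ((decList y).map _).sum < ((decList m).map _).sum at hk
  rw [← excess_eq_sum_decList, ← excess_eq_sum_decList] at hk
  exact absurd (hm.excess_le hy k) (not_le.2 hk)

/-- All dec-min bases share one decreasing rearrangement, and the excess depends on nothing else. -/
theorem mem_decMin_iff (hp : IsSupermodular p) :
    m ∈ decMin (intBase p) ↔ IsLeastMajorized p m := by
  refine ⟨fun h => ?_, fun h => h.mem_decMin⟩
  obtain ⟨x, hx⟩ := exists_isLeastMajorized hp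
  have heq : decList m = decList x := le_antisymm (h.2 x hx.1) (hx.mem_decMin.2 m h.1)
  refine ⟨h.1, fun k => ?_⟩
  rw [excess_eq_sum_decList, heq, ← excess_eq_sum_decList]
  exact hx.2 k

end Excess

/-! ### Weak duality and the optimality criterion -/

section Duality

variable {S : Type*} {p : Finset S → WithBot ℤ} {m π : S → ℤ}

theorem sum_le_coe_sum {ι : Type*} (t : Finset ι) (f : ι → WithBot ℤ) (g : ι → ℤ)
    (h : ∀ i ∈ t, f i ≤ (g i : WithBot ℤ)) :
    ∑ i ∈ t, f i ≤ ((∑ i ∈ t, g i : ℤ) : WithBot ℤ) ∧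
      (∑ i ∈ t, f i = ((∑ i ∈ t, g i : ℤ) : WithBot ℤ) ↔ ∀ i ∈ t, f i = (g i : WithBot ℤ)) := by
  classical
  induction t using Finset.induction_on with
  | empty => simp
  | insert a t ha ih =>
    obtain ⟨ih1, ih2⟩ := ih fun i hi => h i (Finset.mem_insert_of_mem hi)
    have h1 := h a (Finset.mem_insert_self _ _)
    rw [Finset.sum_insert ha, Finset.sum_insert ha, Finset.forall_mem_insert, ← ih2]
    generalize ∑ i ∈ t, f i = x at *
    generalize f a = y at *
    cases x using WithBot.recBotCoe
    · simp only [WithBot.add_bot, bot_le, WithBot.bot_ne_coe, and_false, true_and]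
    cases y using WithBot.recBotCoe
    · simp only [WithBot.bot_add, bot_le, WithBot.bot_ne_coe, false_and, true_and]
    rw [WithBot.coe_le_coe] at ih1 h1
    rw [← WithBot.coe_add, WithBot.coe_le_coe, WithBot.coe_inj, WithBot.coe_inj, WithBot.coe_inj]
    omega

/-- The alternative `d = 0` reflects `⊥ * 0 = 0`: a prefix after which `π` does not drop need not be
tight. -/
theorem mul_coe_le {a : WithBot ℤ} {b d : ℤ} (hd : 0 ≤ d) (h : a ≤ (b : WithBot ℤ)) :
    a * (d : WithBot ℤ) ≤ ((b * d : ℤ) : WithBot ℤ) ∧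
      (a * (d : WithBot ℤ) = ((b * d : ℤ) : WithBot ℤ) ↔ d = 0 ∨ a = (b : WithBot ℤ)) := by
  rcases hd.eq_or_lt with rfl | hd
  · simp
  cases a using WithBot.recBotCoe with
  | bot =>
    rw [WithBot.bot_mul (by simpa using hd.ne')]
    simp only [bot_le, WithBot.bot_ne_coe, hd.ne', or_self, true_and]
  | coe a =>
    rw [WithBot.coe_le_coe] at h
    rw [← WithBot.coe_mul, WithBot.coe_le_coe, WithBot.coe_inj, WithBot.coe_inj]
    refine ⟨mul_le_mul_of_nonneg_right h hd.le, ?_⟩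
    rw [mul_left_inj' hd.ne']
    simp [hd.ne']

theorem abel_sum {n : ℕ} (a b : Fin n → ℤ) :
    ∑ j : Fin n, (∑ i ∈ Finset.Iic j, b i) *
      (if h : (j : ℕ) + 1 < n then a j - a ⟨(j : ℕ) + 1, h⟩ else a j) = ∑ i, a i * b i := by
  -- Extending `a` by zero makes the exceptional last coefficient a difference as well.
  let A : ℕ → ℤ := fun j => if h : j < n then a ⟨j, h⟩ else 0
  have hA : ∀ j : Fin n, (if h : (j : ℕ) + 1 < n then a j - a ⟨(j : ℕ) + 1, h⟩ else a j) =
      A j - A (j + 1) := by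
    intro j
    by_cases h : (j : ℕ) + 1 < n <;> simp [A, h]
  have tel : ∀ i : Fin n, ∑ j ∈ Finset.Ici i, (A j - A (j + 1)) = a i := by
    intro i
    have h1 : ∑ j ∈ Finset.Ici i, (A j - A (j + 1)) =
        ∑ j ∈ Finset.Ico (i : ℕ) n, (A j - A (j + 1)) := by
      rw [← Fin.map_valEmbedding_Ici, Finset.sum_map]
      rfl
    rw [h1, Finset.sum_Ico_eq_sum_range]
    have h2 := Finset.sum_range_sub' (fun j => A (i + j)) (n - i)
    simp only [add_assoc] at h2 ⊢
    rw [h2]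
    have : (i : ℕ) + (n - i) = n := by omega
    simp [A, this]
  simp_rw [hA, Finset.sum_mul]
  rw [Finset.sum_comm' (t' := Finset.univ) (s' := fun i => Finset.Ici i) (by simp)]
  refine Finset.sum_congr rfl fun i _ => ?_
  rw [← Finset.mul_sum, tel, mul_comm]

variable [Fintype S] [DecidableEq S]

/-- Abel summation writes `∑ π m` with the same coefficients as `linExt`, with `m(I_j)` in place of
`p(I_j)`. Equality concerns only the prefixes after which `π` strictly drops; together with `S`
these are the non-empty upper level sets. -/
theorem linExt_le_and_eq_iff (hp : IsSupermodular p) (hm : m ∈ intBase p) (π : S → ℤ) :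
    linExt p π ≤ ((∑ s, π s * m s : ℤ) : WithBot ℤ) ∧
      (linExt p π = ((∑ s, π s * m s : ℤ) : WithBot ℤ) ↔
        ∀ k : ℤ, IsTight p m (Finset.univ.filter fun s => k ≤ π s)) := by
  set e := sortedIndexing π with he
  have hanti : Antitone (fun i => π (e i)) := antitone_sortedIndexing π
  have hsum : ∑ s, π s * m s = ∑ j : Fin (Fintype.card S),
      (∑ s ∈ (Finset.Iic j).image e, m s) * (if h : (j : ℕ) + 1 < Fintype.card S then
        π (e j) - π (e ⟨(j : ℕ) + 1, h⟩) else π (e j)) := by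
    rw [← Equiv.sum_comp e, ← abel_sum (fun i => π (e i)) (fun i => m (e i))]
    refine Finset.sum_congr rfl fun j _ => ?_
    rw [Finset.sum_image e.injective.injOn]
  have himage : ∀ (j : Fin (Fintype.card S)) s, s ∈ (Finset.Iic j).image e ↔ e.symm s ≤ j := by
    intro j s
    rw [Finset.mem_image]
    constructor
    · rintro ⟨i, hi, rfl⟩
      simpa using hi
    · intro h
      exact ⟨e.symm s, by simpa using h, by simp⟩
  have hlast : ∀ j : Fin (Fintype.card S), ¬ (j : ℕ) + 1 < Fintype.card S →
      (Finset.Iic j).image e = Finset.univ := by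
    intro j hj
    ext s
    rw [himage]
    have := (e.symm s).isLt
    simp only [Finset.mem_univ, iff_true, Fin.le_def]
    omega
  have hterm : ∀ j ∈ (Finset.univ : Finset (Fin (Fintype.card S))),
      p ((Finset.Iic j).image e) * (((if h : (j : ℕ) + 1 < Fintype.card S then
          π (e j) - π (e ⟨(j : ℕ) + 1, h⟩) else π (e j)) : ℤ) : WithBot ℤ) ≤
      (((∑ s ∈ (Finset.Iic j).image e, m s) * (if h : (j : ℕ) + 1 < Fintype.card S then
          π (e j) - π (e ⟨(j : ℕ) + 1, h⟩) else π (e j)) : ℤ) : WithBot ℤ) ∧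
      (p ((Finset.Iic j).image e) * (((if h : (j : ℕ) + 1 < Fintype.card S then
          π (e j) - π (e ⟨(j : ℕ) + 1, h⟩) else π (e j)) : ℤ) : WithBot ℤ) =
      (((∑ s ∈ (Finset.Iic j).image e, m s) * (if h : (j : ℕ) + 1 < Fintype.card S then
          π (e j) - π (e ⟨(j : ℕ) + 1, h⟩) else π (e j)) : ℤ) : WithBot ℤ) ↔
        ∀ h : (j : ℕ) + 1 < Fintype.card S, π (e ⟨(j : ℕ) + 1, h⟩) < π (e j) →
          IsTight p m ((Finset.Iic j).image e)) := by
    intro j _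
    by_cases h : (j : ℕ) + 1 < Fintype.card S
    · have hle : π (e ⟨(j : ℕ) + 1, h⟩) ≤ π (e j) := hanti (by simp [Fin.le_def])
      simp only [h, dif_pos, forall_true_left]
      have := mul_coe_le (sub_nonneg.2 hle) (hm.2 ((Finset.Iic j).image e))
      refine ⟨this.1, this.2.trans ?_⟩
      rw [← IsTight]
      constructor
      · rintro (h0 | h0) hlt
        · omega
        · exact h0
      · intro h0
        rcases hle.eq_or_lt with heq | hlt
        · exact Or.inl (by omega)
        · exact Or.inr (h0 hlt)
    -- The last coefficient may be negative, but its prefix is `S`, where `p` and `m` agree.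
    · simp only [h, dif_neg, not_false_eq_true]
      have := isTight_univ hm
      rw [IsTight] at this
      rw [hlast j h, this, WithBot.coe_mul]
      simp
  have hall := sum_le_coe_sum _ _ _ fun j hj => (hterm j hj).1
  rw [hsum]
  refine ⟨hall.1, hall.2.trans ?_⟩
  constructor
  · intro hj k
    by_cases hne : ∃ s, k ≤ π s
    · obtain ⟨s, hs⟩ := hne
      have hne' : (Finset.univ.filter fun i => k ≤ π (e i)).Nonempty :=
        ⟨e.symm s, by simpa using hs⟩
      set j := (Finset.univ.filter fun i => k ≤ π (e i)).max' hne' with hjdef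
      have hjk : k ≤ π (e j) := (Finset.mem_filter.1 (Finset.max'_mem _ hne')).2
      have hI : (Finset.univ.filter fun s => k ≤ π s) = (Finset.Iic j).image e := by
        ext x
        rw [himage, Finset.mem_filter]
        constructor
        · rintro ⟨-, hx⟩
          exact Finset.le_max' _ _ (by simpa using hx)
        · intro hx
          refine ⟨Finset.mem_univ _, hjk.trans ?_⟩
          simpa using hanti hx
      rw [hI]
      by_cases h : (j : ℕ) + 1 < Fintype.card S
      · refine (hterm j (Finset.mem_univ _)).2.1 (hj j (Finset.mem_univ _)) h ?_
        by_contra! hcon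
        have : (⟨(j : ℕ) + 1, h⟩ : Fin _) ≤ j :=
          Finset.le_max' _ _ (by simpa using hjk.trans hcon)
        rw [Fin.le_def] at this
        simp at this
      · rw [hlast j h]
        exact isTight_univ hm
    · have : (Finset.univ.filter fun s => k ≤ π s) = ∅ := by
        ext x
        simpa using fun h => hne ⟨x, h⟩
      rw [this]
      exact isTight_empty hp
  · intro hk j hj
    refine (hterm j hj).2.2 fun h hlt => ?_
    convert hk (π (e j)) using 1
    ext x
    rw [himage, Finset.mem_filter]
    constructor
    · intro hx
      refine ⟨Finset.mem_univ _, ?_⟩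
      simpa using hanti hx
    · rintro ⟨-, hx⟩
      by_contra! hcon
      have : (⟨(j : ℕ) + 1, h⟩ : Fin _) ≤ e.symm x := by
        rw [Fin.le_def]
        exact hcon
      have := hanti this
      simp only [Equiv.apply_symm_apply] at this
      omega

/-- The expression is `(x - a)²` for `z = 2a`, and for `z = 2a + 1` the product `(x - a)(x - a - 1)`
of consecutive integers. -/
theorem sq_sub_mul_add_floor_mul_ceil (x z : ℤ) :
    0 ≤ x ^ 2 - z * x + ⌊(z : ℚ) / 2⌋ * ⌈(z : ℚ) / 2⌉ ∧
      (x ^ 2 - z * x + ⌊(z : ℚ) / 2⌋ * ⌈(z : ℚ) / 2⌉ = 0 ↔ 2 * x - 1 ≤ z ∧ z ≤ 2 * x + 1) := by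
  rcases Int.even_or_odd' z with ⟨a, rfl | rfl⟩
  · have h1 : (((2 * a : ℤ) : ℚ) / 2) = (a : ℤ) := by
      push_cast
      ring
    rw [h1, Int.floor_intCast, Int.ceil_intCast]
    have h2 : x ^ 2 - 2 * a * x + a * a = (x - a) ^ 2 := by ring
    rw [h2]
    refine ⟨sq_nonneg _, ?_⟩
    rw [sq_eq_zero_iff]
    omega
  · have h1 : ⌊(((2 * a + 1 : ℤ) : ℚ) / 2)⌋ = a := by
      rw [Int.floor_eq_iff]
      push_cast
      constructor <;> linarith
    have h2 : ⌈(((2 * a + 1 : ℤ) : ℚ) / 2)⌉ = a + 1 := by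
      rw [Int.ceil_eq_iff]
      push_cast
      constructor <;> linarith
    rw [h1, h2]
    have h3 : x ^ 2 - (2 * a + 1) * x + a * (a + 1) = (x - a) * (x - a - 1) := by ring
    rw [h3]
    constructor
    · rcases le_or_gt x a with h | h
      · exact mul_nonneg_of_nonpos_of_nonpos (by omega) (by omega)
      · exact mul_nonneg (by omega) (by omega)
    · rw [mul_eq_zero]
      omega

/-- Weak duality together with the optimality criterion. -/
theorem dualObjective_le_and_eq_iff (hp : IsSupermodular p) (hm : m ∈ intBase p) (π : S → ℤ) :
    dualObjective p π ≤ ((∑ s, m s ^ 2 : ℤ) : WithBot ℤ) ∧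
      (dualObjective p π = ((∑ s, m s ^ 2 : ℤ) : WithBot ℤ) ↔
        (∀ k : ℤ, IsTight p m (Finset.univ.filter fun s => k ≤ π s)) ∧
          ∀ s, 2 * m s - 1 ≤ π s ∧ π s ≤ 2 * m s + 1) := by
  have h1 := linExt_le_and_eq_iff hp hm π
  have hnn := fun s (_ : s ∈ Finset.univ) => (sq_sub_mul_add_floor_mul_ceil (m s) (π s)).1
  have h2 := Finset.sum_nonneg hnn
  have h3 : _ ↔ ∀ s, 2 * m s - 1 ≤ π s ∧ π s ≤ 2 * m s + 1 :=
    (Finset.sum_eq_zero_iff_of_nonneg hnn).trans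
      ⟨fun h s => (sq_sub_mul_add_floor_mul_ceil _ _).2.1 (h s (Finset.mem_univ _)),
        fun h s _ => (sq_sub_mul_add_floor_mul_ceil _ _).2.2 (h s)⟩
  rw [← h1.2, ← h3]
  rw [Finset.sum_add_distrib, Finset.sum_sub_distrib] at *
  have h4 := h1.1
  unfold dualObjective
  generalize linExt p π = a at *
  cases a using WithBot.recBotCoe
  · simp only [WithBot.map_bot, bot_le, WithBot.bot_ne_coe, false_and, true_and]
  · rw [WithBot.coe_le_coe] at h4
    rw [WithBot.map_coe, WithBot.coe_le_coe, WithBot.coe_inj, WithBot.coe_inj]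
    omega

end Duality

/-! ### The canonical chain as a chain of tilt maximizers -/

section Chain

variable {S : Type*} [Fintype S] [DecidableEq S] {p : Finset S → WithBot ℤ}

/-- The constant shift turns maximizing `hAt p C` on subsets of `Cᶜ` into maximizing one tilt on
supersets of `C`. -/
theorem tilt_eq_hAt_add {C X : Finset S} {c : ℤ} (hC : p C = c) (hX : X ⊆ Cᶜ) :
    tilt p (betaAt p C - 1) (X ∪ C) =
      hAt p C X + ((c - (betaAt p C - 1) * C.card : ℤ) : WithBot ℤ) := by
  have hd : Disjoint X C := by
    rw [Finset.disjoint_left]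
    intro a ha
    simpa using hX ha
  unfold tilt hAt contractFn
  rw [hC, Finset.card_union_of_disjoint hd, WithBot.unbotD_coe]
  cases p (X ∪ C) using WithBot.recBotCoe
  · simp
  · rw [WithBot.map_coe, WithBot.map_coe, ← WithBot.coe_add, ← WithBot.coe_add, WithBot.coe_inj]
    push_cast
    ring

theorem sdiff_subset_compl (Y C : Finset S) : Y \ C ⊆ Cᶜ := by
  intro a ha
  rw [Finset.mem_compl]
  exact (Finset.mem_sdiff.1 ha).2

theorem hAt_le_hAt_iff {C X Y : Finset S} (hC : p C ≠ ⊥) (hX : X ⊆ Cᶜ) (hY : Y ⊆ Cᶜ) :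
    hAt p C X ≤ hAt p C Y ↔
      tilt p (betaAt p C - 1) (X ∪ C) ≤ tilt p (betaAt p C - 1) (Y ∪ C) := by
  obtain ⟨c, hc⟩ := WithBot.ne_bot_iff_exists.1 hC
  rw [tilt_eq_hAt_add hc.symm hX, tilt_eq_hAt_add hc.symm hY]
  generalize hAt p C X = x
  generalize hAt p C Y = y
  cases x using WithBot.recBotCoe
  · simp
  cases y using WithBot.recBotCoe
  · rw [le_bot_iff, WithBot.bot_add, le_bot_iff, ← WithBot.coe_add]
    simp
  rw [← WithBot.coe_add, ← WithBot.coe_add, WithBot.coe_le_coe, WithBot.coe_le_coe]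
  omega

/-- Together the clauses say that `betaAt p C` is the least integer level at which `C` is maximal
among its supersets; they come from `x ≤ ⌈x⌉` and `⌈x⌉ - 1 < x`. -/
theorem betaAt_spec (hp : IsSupermodular p) {C : Finset S} (hC : p C ≠ ⊥)
    (hCu : C ≠ Finset.univ) :
    (∀ Y, C ⊆ Y → tilt p (betaAt p C) Y ≤ tilt p (betaAt p C) C) ∧
      ∃ Y, C ⊆ Y ∧ tilt p (betaAt p C - 1) C < tilt p (betaAt p C - 1) Y := by
  obtain ⟨c, hc⟩ := WithBot.ne_bot_iff_exists.1 hC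
  obtain ⟨u, hu⟩ := WithBot.ne_bot_iff_exists.1 hp.univ_ne_bot
  set T := Cᶜ.powerset.filter (fun X => X.Nonempty) with hT
  set f : Finset S → WithBot ℤ :=
    fun X => (contractFn p C X).map (fun a : ℤ => ⌈(a : ℚ) / (X.card : ℚ)⌉) with hf
  have hmem : ∀ X, X ∈ T ↔ X ⊆ Cᶜ ∧ X.Nonempty := by
    intro X
    rw [hT, Finset.mem_filter, Finset.mem_powerset]
  have hCc : Cᶜ ∈ T := by
    rw [hmem]
    refine ⟨subset_rfl, ?_⟩
    rw [Finset.nonempty_iff_ne_empty, Ne, Finset.compl_eq_empty_iff]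
    exact hCu
  have hval : ∀ X a, p (X ∪ C) = ((a : ℤ) : WithBot ℤ) →
      f X = ((⌈((a - c : ℤ) : ℚ) / (X.card : ℚ)⌉ : ℤ) : WithBot ℤ) := by
    intro X a ha
    simp only [hf, contractFn, ha, ← hc, WithBot.unbotD_coe, WithBot.map_coe]
  have hsup : T.sup f = (betaAt p C : WithBot ℤ) := by
    -- `Cᶜ` contributes a finite value because `p(S)` is finite, so the default of `unbotD` is never
    -- used.
    have : T.sup f ≠ ⊥ := by
      intro hbot
      have h1 := Finset.le_sup (f := f) hCc
      rw [hbot, hval Cᶜ u (by rw [Finset.union_comm, Finset.union_compl, hu]), le_bot_iff] at h1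
      exact WithBot.coe_ne_bot h1
    obtain ⟨b, hb⟩ := WithBot.ne_bot_iff_exists.1 this
    have : betaAt p C = b := by
      change (T.sup f).unbotD 0 = b
      rw [← hb, WithBot.unbotD_coe]
    rw [this, hb]
  have hcard : ∀ Y, C ⊆ Y → (Y.card : ℤ) = (Y \ C).card + C.card := by
    intro Y hY
    rw [← Nat.cast_add, Finset.card_sdiff_add_card_eq_card hY]
  constructor
  · intro Y hY
    rw [tilt_le_tilt_iff hc.symm]
    intro a ha
    rcases (Y \ C).eq_empty_or_nonempty with he | hne
    · have : Y = C := (Finset.sdiff_eq_empty_iff_subset.1 he).antisymm hY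
      subst this
      rw [← hc, WithBot.coe_inj] at ha
      omega
    · have h1 := Finset.le_sup (f := f) ((hmem _).2 ⟨sdiff_subset_compl Y C, hne⟩)
      rw [hsup, hval _ a (by rw [Finset.sdiff_union_of_subset hY, ha]), WithBot.coe_le_coe,
        Int.ceil_le, div_le_iff₀ (by exact_mod_cast hne.card_pos)] at h1
      have h2 : a - c ≤ betaAt p C * (Y \ C).card := by exact_mod_cast h1
      rw [hcard Y hY]
      linarith
  · obtain ⟨X, hX, hXe⟩ := Finset.exists_mem_eq_sup T ⟨_, hCc⟩ f
    rw [hsup] at hXe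
    obtain ⟨hXC, hne⟩ := (hmem X).1 hX
    refine ⟨X ∪ C, Finset.subset_union_right, ?_⟩
    have hd : Disjoint X C := by
      rw [Finset.disjoint_left]
      intro a ha
      simpa using hXC ha
    cases ha : p (X ∪ C) using WithBot.recBotCoe with
    | bot =>
      exfalso
      have : f X = ⊥ := by simp [hf, contractFn, ha]
      rw [this] at hXe
      exact WithBot.coe_ne_bot hXe
    | coe a =>
      rw [hval X a ha, WithBot.coe_inj] at hXe
      rw [← not_le, tilt_le_tilt_iff hc.symm]
      intro hle
      have h2 := hle a ha
      have h3 : betaAt p C - 1 < ((a - c : ℤ) : ℚ) / (X.card : ℚ) := by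
        have := Int.ceil_lt_add_one (((a - c : ℤ) : ℚ) / (X.card : ℚ))
        rw [← hXe] at this
        linarith
      rw [lt_div_iff₀ (by exact_mod_cast hne.card_pos)] at h3
      have h4 : (betaAt p C - 1) * X.card < a - c := by exact_mod_cast h3
      rw [Finset.card_union_of_disjoint hd] at h2
      push_cast at h2
      linarith

theorem tilt_supermodular (hp : IsSupermodular p) (k : ℤ) (X Y : Finset S) :
    tilt p k X + tilt p k Y ≤ tilt p k (X ∩ Y) + tilt p k (X ∪ Y) := by
  have h1 := hp.supermodular X Y
  have h2 : (X ∪ Y).card + (X ∩ Y).card = X.card + Y.card := Finset.card_union_add_card_inter X Y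
  have h3 : (-(k * X.card) : ℤ) + -(k * Y.card) = -(k * (X ∩ Y).card) + -(k * (X ∪ Y).card) := by
    have : ((X ∪ Y).card : ℤ) + (X ∩ Y).card = X.card + Y.card := by exact_mod_cast h2
    linear_combination k * this
  unfold tilt
  rw [add_add_add_comm, add_add_add_comm (p (X ∩ Y)), ← WithBot.coe_add, ← WithBot.coe_add, h3]
  gcongr

/-- Maximizers of a supermodular function are closed under intersection, so one of least cardinality
lies in all others, and the intersection defining `peakAt` is itself a maximizer. -/
theorem peakAt_spec (hp : IsSupermodular p) {C : Finset S} (hC : p C ≠ ⊥) :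
    p (C ∪ peakAt p C) ≠ ⊥ ∧
    (∀ Y, C ⊆ Y → tilt p (betaAt p C - 1) Y ≤ tilt p (betaAt p C - 1) (C ∪ peakAt p C)) ∧
      ∀ Y, C ⊆ Y → tilt p (betaAt p C - 1) (C ∪ peakAt p C) ≤ tilt p (betaAt p C - 1) Y →
        C ∪ peakAt p C ⊆ Y := by
  set k := betaAt p C - 1 with hk
  let M : Finset (Finset S) := Finset.univ.filter fun Y =>
    C ⊆ Y ∧ ∀ Y', C ⊆ Y' → tilt p k Y' ≤ tilt p k Y
  have hM : ∀ Y, Y ∈ M ↔ C ⊆ Y ∧ ∀ Y', C ⊆ Y' → tilt p k Y' ≤ tilt p k Y := by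
    intro Y
    simp [M]
  have hMne : M.Nonempty := by
    obtain ⟨Y, hY, hmax⟩ := Finset.exists_max_image (Finset.univ.filter fun Y => C ⊆ Y)
      (tilt p k) ⟨C, by simp⟩
    refine ⟨Y, (hM Y).2 ⟨by simpa using hY, fun Y' hY' => hmax Y' (by simpa using hY')⟩⟩
  have hfin : ∀ Y ∈ M, p Y ≠ ⊥ := by
    intro Y hY hbot
    have h1 := ((hM Y).1 hY).2 C subset_rfl
    obtain ⟨c, hc⟩ := WithBot.ne_bot_iff_exists.1 hC
    rw [tilt, tilt, hbot, ← hc, WithBot.bot_add, le_bot_iff, ← WithBot.coe_add] at h1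
    exact WithBot.coe_ne_bot h1
  obtain ⟨Y₀, hY₀, hmin⟩ := Finset.exists_min_image M Finset.card hMne
  have hinter : ∀ Y ∈ M, Y₀ ∩ Y ∈ M := by
    intro Y hY
    obtain ⟨hCY, hYmax⟩ := (hM Y).1 hY
    obtain ⟨hCY₀, hY₀max⟩ := (hM Y₀).1 hY₀
    refine (hM _).2 ⟨Finset.subset_inter hCY₀ hCY, fun Y' hY' => (hY₀max Y' hY').trans ?_⟩
    have h1 := tilt_supermodular hp k Y₀ Y
    have h2 := hYmax (Y₀ ∪ Y) (hCY.trans Finset.subset_union_right)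
    obtain ⟨b, hb⟩ := WithBot.ne_bot_iff_exists.1 (hfin Y hY)
    have hT : tilt p k Y = ((b - k * Y.card : ℤ) : WithBot ℤ) := by
      rw [tilt, ← hb, ← WithBot.coe_add, sub_eq_add_neg]
    have h3 := h1.trans (add_le_add_right h2 _)
    rw [hT] at h3
    exact (WithBot.add_le_add_iff_right WithBot.coe_ne_bot).1 h3
  have hleast : ∀ Y ∈ M, Y₀ ⊆ Y := by
    intro Y hY
    have h1 := Finset.eq_of_subset_of_card_le Finset.inter_subset_left (hmin _ (hinter Y hY))
    rw [← h1]
    exact Finset.inter_subset_right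
  have hmaxM : ∀ X, X ⊆ Cᶜ →
      ((∀ Y ∈ Cᶜ.powerset, hAt p C Y ≤ hAt p C X) ↔ X ∪ C ∈ M) := by
    intro X hX
    rw [hM]
    constructor
    · intro h
      refine ⟨Finset.subset_union_right, fun Y' hY' => ?_⟩
      have := (hAt_le_hAt_iff hC (sdiff_subset_compl Y' C) hX).1
        (h _ (Finset.mem_powerset.2 (sdiff_subset_compl Y' C)))
      rwa [Finset.sdiff_union_of_subset hY'] at this
    · rintro ⟨-, h⟩ Y hY
      exact (hAt_le_hAt_iff hC (Finset.mem_powerset.1 hY) hX).2 (h _ Finset.subset_union_right)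
  have hCY₀ := ((hM Y₀).1 hY₀).1
  have hpeak : C ∪ peakAt p C = Y₀ := by
    ext s
    by_cases hs : s ∈ C
    · simp [hs, hCY₀ hs]
    · rw [Finset.mem_union, peakAt, Finset.mem_filter]
      constructor
      · rintro (h | ⟨-, h⟩)
        · exact absurd h hs
        · have := h (Y₀ \ C) (Finset.mem_powerset.2 (sdiff_subset_compl _ _))
            ((hmaxM _ (sdiff_subset_compl _ _)).2 (by rwa [Finset.sdiff_union_of_subset hCY₀]))
          exact (Finset.mem_sdiff.1 this).1
      · intro hsY
        refine Or.inr ⟨Finset.mem_compl.2 hs, fun X hX hXmax => ?_⟩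
        have := hleast _ ((hmaxM X (Finset.mem_powerset.1 hX)).1 hXmax) hsY
        exact (Finset.mem_union.1 this).resolve_right hs
  rw [hpeak]
  refine ⟨hfin _ hY₀, ((hM Y₀).1 hY₀).2, fun Y hCY hle => hleast Y ((hM Y).2 ⟨hCY, ?_⟩)⟩
  exact fun Y' hY' => (((hM Y₀).1 hY₀).2 Y' hY').trans hle

theorem peakAt_subset_compl (p : Finset S → WithBot ℤ) (C : Finset S) : peakAt p C ⊆ Cᶜ :=
  Finset.filter_subset _ _

theorem peakAt_nonempty (hp : IsSupermodular p) {C : Finset S} (hC : p C ≠ ⊥)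
    (hCu : C ≠ Finset.univ) : (peakAt p C).Nonempty := by
  rw [Finset.nonempty_iff_ne_empty]
  intro he
  obtain ⟨Y, hCY, hY⟩ := (betaAt_spec hp hC hCu).2
  have := (peakAt_spec hp hC).2.1 Y hCY
  rw [he, Finset.union_empty] at this
  exact absurd this (not_le.2 hY)

theorem canonChain_succ (p : Finset S → WithBot ℤ) (i : ℕ) :
    canonChain p (i + 1) = canonChain p i ∪ canonPart p i := rfl

theorem canonChain_ne_bot (hp : IsSupermodular p) (i : ℕ) : p (canonChain p i) ≠ ⊥ := by
  induction i with
  | zero =>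
    rw [canonChain, hp.empty]
    exact WithBot.coe_ne_bot
  | succ i ih => exact (peakAt_spec hp ih).1

theorem mem_canonChain_iff (p : Finset S → WithBot ℤ) (i : ℕ) (s : S) :
    s ∈ canonChain p i ↔ ∃ j < i, s ∈ canonPart p j := by
  induction i with
  | zero => simp [canonChain]
  | succ i ih =>
    rw [canonChain_succ, Finset.mem_union, ih]
    constructor
    · rintro (⟨j, hj, hs⟩ | hs)
      · exact ⟨j, hj.trans (Nat.lt_succ_self _), hs⟩
      · exact ⟨i, Nat.lt_succ_self _, hs⟩
    · rintro ⟨j, hj, hs⟩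
      rcases (Nat.lt_succ_iff.1 hj).lt_or_eq with hj | rfl
      · exact Or.inl ⟨j, hj, hs⟩
      · exact Or.inr hs

theorem notMem_canonChain_of_mem_canonPart {i : ℕ} {s : S} (hs : s ∈ canonPart p i) :
    s ∉ canonChain p i :=
  Finset.mem_compl.1 (peakAt_subset_compl p _ hs)

theorem canonChain_ne_univ {i : ℕ} (hi : i < numParts p) : canonChain p i ≠ Finset.univ :=
  Nat.notMem_of_lt_sInf hi

theorem canonChain_numParts (hp : IsSupermodular p) :
    canonChain p (numParts p) = Finset.univ := by
  -- The infimum is meaningful only if the chain reaches `S`. If it never did, each step would add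
  -- an element, giving `i ≤ |C_i|` for all `i`.
  refine Nat.sInf_mem (s := {i | canonChain p i = Finset.univ}) ?_
  by_contra hne
  have hne' : ∀ i, canonChain p i ≠ Finset.univ := fun i hi => hne ⟨i, hi⟩
  have hcard : ∀ i, i ≤ (canonChain p i).card := by
    intro i
    induction i with
    | zero => exact Nat.zero_le _
    | succ i ih =>
      rw [canonChain_succ, Finset.card_union_of_disjoint]
      · have := (peakAt_nonempty hp (canonChain_ne_bot hp i) (hne' i)).card_pos
        rw [canonPart]
        omega
      · exact Finset.disjoint_right.2 fun s hs => notMem_canonChain_of_mem_canonPart hs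
  have h1 := hcard (Fintype.card S + 1)
  have h2 := Finset.card_le_univ (canonChain p (Fintype.card S + 1))
  omega

theorem exists_mem_canonPart (hp : IsSupermodular p) (s : S) :
    ∃ i < numParts p, s ∈ canonPart p i := by
  rw [← mem_canonChain_iff, canonChain_numParts hp]
  exact Finset.mem_univ s

/-- If `β_{i+1} ≥ β_i`, then `C_{i+1}`, maximal at level `β_i - 1`, stays maximal among its
supersets at the higher level `β_{i+1} - 1`, against `betaAt_spec`. -/
theorem essValue_succ_lt (hp : IsSupermodular p) {i : ℕ} (hi : i + 1 < numParts p) :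
    essValue p (i + 1) < essValue p i := by
  by_contra! hle
  have hC := canonChain_ne_bot hp (i + 1)
  obtain ⟨Y, hCY, hY⟩ := (betaAt_spec hp hC (canonChain_ne_univ hi)).2
  have h1 := (peakAt_spec hp (canonChain_ne_bot hp i)).2.1 Y
    ((canonChain_succ p i ▸ Finset.subset_union_left).trans hCY)
  refine absurd (tilt_le_tilt_of_le (k' := essValue p (i + 1) - 1) hC h1 ?_) (not_le.2 hY)
  refine mul_le_mul_of_nonneg_left (by exact_mod_cast Finset.card_le_card hCY) ?_
  change 0 ≤ essValue p (i + 1) - 1 - (essValue p i - 1)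
  omega

theorem essValue_lt (hp : IsSupermodular p) {i j : ℕ} (hij : i < j) (hj : j < numParts p) :
    essValue p j < essValue p i := by
  induction j, hij using Nat.le_induction with
  | base => exact essValue_succ_lt hp hj
  | succ j _ ih => exact (essValue_succ_lt hp hj).trans (ih (by omega))

theorem disjoint_canonPart {i j : ℕ} (hij : i < j) :
    Disjoint (canonPart p i) (canonPart p j) := by
  rw [Finset.disjoint_left]
  intro s hs hs'
  exact notMem_canonChain_of_mem_canonPart hs' ((mem_canonChain_iff p j s).2 ⟨i, hij, hs⟩)

theorem canonPart_index_unique {i j : ℕ} {s : S} (hi : s ∈ canonPart p i)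
    (hj : s ∈ canonPart p j) : i = j := by
  rcases lt_trichotomy i j with h | h | h
  · exact absurd hj (Finset.disjoint_left.1 (disjoint_canonPart h) hi)
  · exact h
  · exact absurd hi (Finset.disjoint_left.1 (disjoint_canonPart h) hj)

/-- At the lower level `k`, `C` still beats its subset `X ∩ C`, so uncrossing `X` with `C` leaves
the gain to `X ∪ C`. This upgrades maximality among supersets of `C` to maximality among all sets.
-/
theorem tilt_le_tilt_union (hp : IsSupermodular p) {C : Finset S} {k k' : ℤ} (hC : p C ≠ ⊥)
    (h : ∀ X, tilt p k' X ≤ tilt p k' C) (hk : k ≤ k') (X : Finset S) :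
    tilt p k X ≤ tilt p k (X ∪ C) := by
  have h1 := tilt_supermodular hp k X C
  have h2 : tilt p k (X ∩ C) ≤ tilt p k C := by
    refine tilt_le_tilt_of_le hC (h _) ?_
    have : ((X ∩ C).card : ℤ) ≤ C.card := by
      exact_mod_cast Finset.card_le_card Finset.inter_subset_right
    nlinarith
  obtain ⟨c, hc⟩ := WithBot.ne_bot_iff_exists.1 hC
  have hT : tilt p k C = ((c - k * C.card : ℤ) : WithBot ℤ) := by
    rw [tilt, ← hc, ← WithBot.coe_add, sub_eq_add_neg]
  have h3 := h1.trans (add_le_add_left h2 _)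
  rw [add_comm (tilt p k C), hT] at h3
  exact (WithBot.add_le_add_iff_right WithBot.coe_ne_bot).1 h3

theorem tilt_succ_le_of_tilt_le (hp : IsSupermodular p) {i : ℕ}
    (h : ∀ X, tilt p (essValue p i) X ≤ tilt p (essValue p i) (canonChain p i)) (X : Finset S) :
    tilt p (essValue p i - 1) X ≤ tilt p (essValue p i - 1) (canonChain p (i + 1)) :=
  (tilt_le_tilt_union hp (canonChain_ne_bot hp i) h (by omega) X).trans
    ((peakAt_spec hp (canonChain_ne_bot hp i)).2.1 _ Finset.subset_union_right)

/-- The levels descend through `β_i`, `β_i - 1`, `β_{i+1}`: maximality of `C_i` at the first gives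
that of `C_{i+1}` at the second, and then at the third since `β_{i+1} ≤ β_i - 1`. -/
theorem tilt_essValue_le (hp : IsSupermodular p) {i : ℕ} (hi : i < numParts p) (X : Finset S) :
    tilt p (essValue p i) X ≤ tilt p (essValue p i) (canonChain p i) := by
  induction i generalizing X with
  | zero =>
    exact (betaAt_spec hp (canonChain_ne_bot hp 0) (canonChain_ne_univ hi)).1 X (by simp [canonChain])
  | succ i ih =>
    have h1 := tilt_succ_le_of_tilt_le hp (ih (by omega))
    have h2 := essValue_succ_lt hp hi
    exact (tilt_le_tilt_union hp (canonChain_ne_bot hp _) h1 (by omega) X).trans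
      ((betaAt_spec hp (canonChain_ne_bot hp _) (canonChain_ne_univ hi)).1 _
        Finset.subset_union_right)

theorem tilt_essValue_sub_one_le (hp : IsSupermodular p) {i : ℕ} (hi : i < numParts p)
    (X : Finset S) :
    tilt p (essValue p i - 1) X ≤ tilt p (essValue p i - 1) (canonChain p (i + 1)) :=
  tilt_succ_le_of_tilt_le hp (tilt_essValue_le hp hi) X

end Chain

/-! ### Value-fixed elements and the description of the dual optima -/

section Optima

variable {S : Type*} [Fintype S] [DecidableEq S] {p : Finset S → WithBot ℤ} {m π : S → ℤ}

theorem IsLeastMajorized.canonChain_isTight (hp : IsSupermodular p) (hm : IsLeastMajorized p m)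
    {i : ℕ} (hi : i < numParts p) :
    IsTight p m (canonChain p i) ∧ (∀ s ∈ canonChain p i, essValue p i ≤ m s) ∧
      ∀ s ∉ canonChain p i, m s ≤ essValue p i := by
  obtain ⟨Z, hZ⟩ := hm.2 (essValue p i)
  exact isTight_of_tilt_max hm.1 hZ (tilt_essValue_le hp hi)

theorem IsLeastMajorized.canonChain_succ_isTight (hp : IsSupermodular p)
    (hm : IsLeastMajorized p m) {i : ℕ} (hi : i < numParts p) :
    IsTight p m (canonChain p (i + 1)) ∧
      (∀ s ∈ canonChain p (i + 1), essValue p i - 1 ≤ m s) ∧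
      ∀ s ∉ canonChain p (i + 1), m s ≤ essValue p i - 1 := by
  obtain ⟨Z, hZ⟩ := hm.2 (essValue p i - 1)
  exact isTight_of_tilt_max hm.1 hZ (tilt_essValue_sub_one_le hp hi)

theorem IsLeastMajorized.mem_Icc (hp : IsSupermodular p) (hm : IsLeastMajorized p m)
    {i : ℕ} (hi : i < numParts p) {s : S} (hs : s ∈ canonPart p i) :
    essValue p i - 1 ≤ m s ∧ m s ≤ essValue p i :=
  ⟨(hm.canonChain_succ_isTight hp hi).2.1 s (Finset.mem_union_right _ hs),
    (hm.canonChain_isTight hp hi).2.2 s (notMem_canonChain_of_mem_canonPart hs)⟩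

theorem IsLeastMajorized.isTight_inter_union (hp : IsSupermodular p) (hm : IsLeastMajorized p m)
    {i : ℕ} (hi : i < numParts p) {Z : Finset S} (hZ : IsTight p m Z) :
    IsTight p m (Z ∩ canonPart p i ∪ canonChain p i) := by
  have h1 := ((hZ.inter hp hm.1 (hm.canonChain_succ_isTight hp hi).1).union hp hm.1
    (hm.canonChain_isTight hp hi).1)
  convert h1 using 1
  ext s
  simp only [canonChain_succ, Finset.mem_union, Finset.mem_inter]
  tauto

/-- Since `C_i` is tight, `p_i(X) ≤ m(X) ≤ β_i |X|`, and membership forces equality in both. -/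
theorem IsLeastMajorized.mem_tightFamily_iff (hp : IsSupermodular p) (hm : IsLeastMajorized p m)
    {i : ℕ} (hi : i < numParts p) {X : Finset S} :
    X ∈ tightFamily p i ↔ X ⊆ canonPart p i ∧ IsTight p m (X ∪ canonChain p i) ∧
      ∀ s ∈ X, m s = essValue p i := by
  rw [tightFamily, Finset.mem_filter, Finset.mem_powerset]
  refine and_congr_right fun hX => ?_
  have hd : Disjoint X (canonChain p i) :=
    Finset.disjoint_left.2 fun s hs => notMem_canonChain_of_mem_canonPart (hX hs)
  have hC := (hm.canonChain_isTight hp hi).1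
  have h1 := hm.1.2 (X ∪ canonChain p i)
  have h2 : ∀ s ∈ X, m s ≤ essValue p i := fun s hs => (hm.mem_Icc hp hi (hX hs)).2
  have h3 := Finset.sum_eq_sum_iff_of_le h2
  have h4 := Finset.sum_le_sum h2
  rw [← h3]
  unfold IsTight contractFn at *
  rw [hC, WithBot.unbotD_coe]
  rw [Finset.sum_union hd] at h1 ⊢
  have h5 : ∑ _s ∈ X, essValue p i = essValue p i * X.card := by
    rw [Finset.sum_const, nsmul_eq_mul, mul_comm]
  rw [h5] at h4 ⊢
  generalize p (X ∪ canonChain p i) = a at *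
  cases a using WithBot.recBotCoe
  · simp only [WithBot.map_bot, WithBot.bot_ne_coe, false_and]
  · rw [WithBot.coe_le_coe] at h1
    rw [WithBot.map_coe, WithBot.coe_inj, WithBot.coe_inj]
    omega

theorem mem_fixedPart_iff {i : ℕ} {s : S} :
    s ∈ fixedPart p i ↔ ∃ X ∈ tightFamily p i, s ∈ X := by
  simp [fixedPart]

theorem fixedPart_subset_canonPart {i : ℕ} {s : S} (hs : s ∈ fixedPart p i) :
    s ∈ canonPart p i := by
  obtain ⟨X, hX, hsX⟩ := mem_fixedPart_iff.1 hs
  exact Finset.mem_powerset.1 (Finset.mem_filter.1 hX).1 hsX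

theorem IsLeastMajorized.eq_essValue (hp : IsSupermodular p) (hm : IsLeastMajorized p m)
    {i : ℕ} (hi : i < numParts p) {s : S} (hs : s ∈ fixedPart p i) : m s = essValue p i := by
  obtain ⟨X, hX, hsX⟩ := mem_fixedPart_iff.1 hs
  exact ((hm.mem_tightFamily_iff hp hi).1 hX).2.2 s hsX

/-- A unit exchange between values differing by one merely transposes them, so no excess changes. -/
theorem IsLeastMajorized.swap (hm : IsLeastMajorized p m) {s t : S} (hst : m t = m s + 1)
    (h : ∀ Z, IsTight p m Z → t ∈ Z → s ∈ Z) :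
    IsLeastMajorized p (m ∘ Equiv.swap s t) := by
  refine ⟨?_, fun k => ?_⟩
  · convert exchange_mem_intBase hm.1 h using 1
    have hne : s ≠ t := by
      rintro rfl
      omega
    ext x
    rw [Function.comp_apply]
    by_cases hs : x = s
    · subst hs
      simp [hne, hst]
    by_cases ht : x = t
    · subst ht
      simp [hne.symm, hst]
    rw [Equiv.swap_apply_of_ne_of_ne hs ht]
    simp [hs, ht]
  · obtain ⟨Z, hZ⟩ := hm.2 k
    refine ⟨Z, hZ.trans ?_⟩
    congr 1
    exact (Equiv.sum_comp (Equiv.swap s t) fun x => max (m x - k) 0).symm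

/-- If `m s = β_i` always, no swap can lower `s`. Then a tight set contains `s` and avoids all
elements of `S_i` with value `β_i - 1`; its trace on `S_i` lies in `tightFamily p i`, so `s ∈ F_i`.
-/
theorem exists_isLeastMajorized_eq_sub_one (hp : IsSupermodular p) {i : ℕ}
    (hi : i < numParts p) {s : S} (hs : s ∈ canonPart p i) (hF : s ∉ fixedPart p i) :
    ∃ m, IsLeastMajorized p m ∧ m s = essValue p i - 1 := by
  obtain ⟨m, hm⟩ := exists_isLeastMajorized hp
  by_contra! hcon
  have hI := fun t (ht : t ∈ canonPart p i) => hm.mem_Icc hp hi ht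
  have hms : m s = essValue p i := by
    have := hcon m hm
    have := hI s hs
    omega
  obtain ⟨Z, hZ, h1, h2⟩ := exists_isTight_separating hp hm.1 {s}
    ((canonPart p i).filter fun t => m t = essValue p i - 1) (by
      intro s' hs' t ht
      rw [Finset.mem_singleton] at hs'
      subst hs'
      rw [Finset.mem_filter] at ht
      by_contra! h
      refine hcon _ (hm.swap (s := t) (t := s') (by omega) h) ?_
      simp [ht.2])
  refine hF (mem_fixedPart_iff.2 ⟨Z ∩ canonPart p i, (hm.mem_tightFamily_iff hp hi).2
    ⟨Finset.inter_subset_right, hm.isTight_inter_union hp hi hZ, fun t ht => ?_⟩,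
    Finset.mem_inter.2 ⟨h1 s (Finset.mem_singleton_self _), hs⟩⟩)
  rw [Finset.mem_inter] at ht
  have h3 := hI t ht.2
  have h4 : m t ≠ essValue p i - 1 := fun h => h2 t (Finset.mem_filter.2 ⟨ht.2, h⟩) ht.1
  omega

/-- If `m s = β_i - 1` always, a tight set avoids `s` and contains all elements of `S_i` with value
`β_i`. Its trace on `S_i` together with `C_i` maximizes the tilt at level `β_i - 1`, yet misses `s`,
against the minimality of the peak-set. -/
theorem exists_isLeastMajorized_eq (hp : IsSupermodular p) {i : ℕ}
    (hi : i < numParts p) {s : S} (hs : s ∈ canonPart p i) :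
    ∃ m, IsLeastMajorized p m ∧ m s = essValue p i := by
  obtain ⟨m, hm⟩ := exists_isLeastMajorized hp
  by_contra! hcon
  have hI := fun t (ht : t ∈ canonPart p i) => hm.mem_Icc hp hi ht
  have hms : m s = essValue p i - 1 := by
    have := hcon m hm
    have := hI s hs
    omega
  obtain ⟨Z, hZ, h1, h2⟩ := exists_isTight_separating hp hm.1
    ((canonPart p i).filter fun t => m t = essValue p i) {s} (by
      intro t ht s' hs'
      rw [Finset.mem_singleton] at hs'
      subst hs'
      rw [Finset.mem_filter] at ht
      by_contra! h
      refine hcon _ (hm.swap (s := s') (t := t) (by omega) h) ?_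
      simp [ht.2])
  have hC := hm.canonChain_succ_isTight hp hi
  have hsub : Z ∩ canonPart p i ∪ canonChain p i ⊆ canonChain p (i + 1) := by
    rw [canonChain_succ]
    exact Finset.union_subset (Finset.inter_subset_right.trans Finset.subset_union_right)
      Finset.subset_union_left
  have hZ' := (tilt_eq_excess_iff hm.1 (essValue p i - 1) (Z ∩ canonPart p i ∪ canonChain p i)).2
    ⟨hm.isTight_inter_union hp hi hZ, fun t ht => hC.2.1 t (hsub ht), fun t ht => ?_⟩
  · have hle := tilt_le_excess hm.1 (essValue p i - 1) (canonChain p (i + 1))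
    rw [← hZ'] at hle
    have := (peakAt_spec hp (canonChain_ne_bot hp i)).2.2 _ Finset.subset_union_right hle
      (Finset.mem_union_right _ hs)
    rcases Finset.mem_union.1 this with h | h
    · exact h2 s (Finset.mem_singleton_self _) (Finset.mem_inter.1 h).1
    · exact notMem_canonChain_of_mem_canonPart hs h
  · by_cases ht' : t ∈ canonPart p i
    · have h3 := hI t ht'
      have h4 : m t ≠ essValue p i := fun h =>
        ht (Finset.mem_union_left _ (Finset.mem_inter.2 ⟨h1 t (Finset.mem_filter.2 ⟨ht', h⟩), ht'⟩))
      omega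
    · refine hC.2.2 t ?_
      rw [canonChain_succ, Finset.mem_union]
      rintro (h | h)
      · exact ht (Finset.mem_union_right _ h)
      · exact ht' h

theorem mem_fixedPart_iff_isValueFixed (hp : IsSupermodular p) {i : ℕ} (hi : i < numParts p)
    (s : S) : s ∈ fixedPart p i ↔ s ∈ canonPart p i ∧ IsValueFixed p s := by
  constructor
  · intro hs
    refine ⟨fixedPart_subset_canonPart hs, fun m hm m' hm' => ?_⟩
    rw [((mem_decMin_iff hp).1 hm).eq_essValue hp hi hs,
      ((mem_decMin_iff hp).1 hm').eq_essValue hp hi hs]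
  · rintro ⟨hs, hfix⟩
    by_contra hF
    obtain ⟨m, hm, h1⟩ := exists_isLeastMajorized_eq_sub_one hp hi hs hF
    obtain ⟨m', hm', h2⟩ := exists_isLeastMajorized_eq hp hi hs
    have := hfix m hm.mem_decMin m' hm'.mem_decMin
    omega

/-- The description of the optimal duals by bounds and by the arcs of the digraphs. -/
def IsCanonDual (p : Finset S → WithBot ℤ) (π : S → ℤ) : Prop :=
  ∀ i < numParts p,
    (∀ s ∈ canonPart p i \ fixedPart p i, π s = 2 * essValue p i - 1) ∧
    (∀ s ∈ fixedPart p i, 2 * essValue p i - 1 ≤ π s ∧ π s ≤ 2 * essValue p i + 1) ∧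
    (∀ s t : S, IsArc p i s t → π t ≤ π s)

theorem IsCanonDual.bounds (h : IsCanonDual p π) {i : ℕ} (hi : i < numParts p) {s : S}
    (hs : s ∈ canonPart p i) : 2 * essValue p i - 1 ≤ π s ∧ π s ≤ 2 * essValue p i + 1 := by
  by_cases hF : s ∈ fixedPart p i
  · exact (h i hi).2.1 s hF
  · have := (h i hi).1 s (Finset.mem_sdiff.2 ⟨hs, hF⟩)
    omega

/-- Let `i` be the first part where `π` falls below `k`. The level set contains all earlier parts
and meets no later one. Inside `S_i` it lies in `F_i`, as `k > 2β_i - 1`, and the missing arcs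
supply the separating tight sets. -/
theorem IsCanonDual.isTight_upperLevel (hp : IsSupermodular p) (hm : IsLeastMajorized p m)
    (hπ : IsCanonDual p π) (k : ℤ) :
    IsTight p m (Finset.univ.filter fun s => k ≤ π s) := by
  classical
  by_cases hex : ∃ i, i < numParts p ∧ ∃ s ∈ canonPart p i, π s < k
  swap
  · have : (Finset.univ.filter fun s => k ≤ π s) = Finset.univ := by
      ext s
      obtain ⟨i, hi, hs⟩ := exists_mem_canonPart hp s
      simp only [Finset.mem_filter, Finset.mem_univ, true_and, iff_true]
      by_contra! h
      exact hex ⟨i, hi, s, hs, h⟩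
    rw [this]
    exact isTight_univ hm.1
  obtain ⟨hi, s₀, hs₀, hk₀⟩ := Nat.find_spec hex
  have hmin : ∀ j < Nat.find hex, j < numParts p → ∀ s ∈ canonPart p j, k ≤ π s := by
    intro j hj hj' s hs
    by_contra! h
    exact Nat.find_min hex hj ⟨hj', s, hs, h⟩
  generalize Nat.find hex = i at hi hs₀ hmin
  have hlow := (hπ.bounds hi hs₀).1
  obtain ⟨Z, hZ, h1, h2⟩ := exists_isTight_separating hp hm.1
    ((canonPart p i).filter fun t => k ≤ π t) ((canonPart p i).filter fun s => π s < k) (by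
      intro t ht s hs
      rw [Finset.mem_filter] at ht hs
      have htF : t ∈ fixedPart p i := by
        by_contra htF
        have := (hπ i hi).1 t (Finset.mem_sdiff.2 ⟨ht.1, htF⟩)
        omega
      have hW : ∃ W ∈ tightFamily p i, t ∈ W ∧ s ∉ W := by
        by_cases hsF : s ∈ fixedPart p i
        · by_contra hW
          have := (hπ i hi).2.2 s t ⟨hsF, htF, by rintro rfl; omega, hW⟩
          omega
        · obtain ⟨W, hW, htW⟩ := mem_fixedPart_iff.1 htF
          exact ⟨W, hW, htW, fun hsW => hsF (mem_fixedPart_iff.2 ⟨W, hW, hsW⟩)⟩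
      obtain ⟨W, hW, htW, hsW⟩ := hW
      refine ⟨_, ((hm.mem_tightFamily_iff hp hi).1 hW).2.1, Finset.mem_union_left _ htW, ?_⟩
      rw [Finset.mem_union]
      rintro (h | h)
      · exact hsW h
      · exact notMem_canonChain_of_mem_canonPart hs.1 h)
  convert hm.isTight_inter_union hp hi hZ using 1
  ext s
  obtain ⟨j, hj, hs⟩ := exists_mem_canonPart hp s
  rw [Finset.mem_filter, Finset.mem_union, Finset.mem_inter]
  rcases lt_trichotomy j i with hji | rfl | hji
  · have := hmin j hji hj s hs
    have h3 := (mem_canonChain_iff p i s).2 ⟨j, hji, hs⟩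
    simp [this, h3]
  · have h3 := notMem_canonChain_of_mem_canonPart hs
    simp only [Finset.mem_univ, true_and, hs, and_true, h3, or_false]
    constructor
    · intro h
      exact h1 s (Finset.mem_filter.2 ⟨hs, h⟩)
    · intro h
      by_contra! h'
      exact h2 s (Finset.mem_filter.2 ⟨hs, h'⟩) h
  · have h3 : s ∉ canonPart p i := fun h => hji.ne (canonPart_index_unique h hs)
    have h4 : s ∉ canonChain p i := by
      rw [mem_canonChain_iff]
      rintro ⟨l, hl, hsl⟩
      have := canonPart_index_unique hsl hs
      omega
    have h5 := (hπ.bounds hj hs).2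
    have h6 := essValue_lt hp hji hj
    -- Here `π s ≤ 2β_j + 1 ≤ 2β_i - 1 ≤ π s₀ < k`.
    have h7 : ¬ k ≤ π s := by omega
    simp [h3, h4, h7]

theorem IsCanonDual.dualObjective_eq (hp : IsSupermodular p) (hm : IsLeastMajorized p m)
    (hπ : IsCanonDual p π) : dualObjective p π = ((∑ s, m s ^ 2 : ℤ) : WithBot ℤ) := by
  refine (dualObjective_le_and_eq_iff hp hm.1 π).2.2
    ⟨hπ.isTight_upperLevel hp hm, fun s => ?_⟩
  obtain ⟨i, hi, hs⟩ := exists_mem_canonPart hp s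
  by_cases hF : s ∈ fixedPart p i
  · rw [hm.eq_essValue hp hi hF]
    exact (hπ i hi).2.1 s hF
  · have h1 := (hπ i hi).1 s (Finset.mem_sdiff.2 ⟨hs, hF⟩)
    have h2 := hm.mem_Icc hp hi hs
    omega

theorem isCanonDual_of_forall (hp : IsSupermodular p)
    (h : ∀ m, IsLeastMajorized p m → (∀ k : ℤ, IsTight p m (Finset.univ.filter fun s => k ≤ π s)) ∧
      ∀ s, 2 * m s - 1 ≤ π s ∧ π s ≤ 2 * m s + 1) : IsCanonDual p π := by
  obtain ⟨m, hm⟩ := exists_isLeastMajorized hp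
  intro i hi
  have hunfixed : ∀ s ∈ canonPart p i, s ∉ fixedPart p i → π s = 2 * essValue p i - 1 := by
    intro s hs hF
    obtain ⟨m₁, hm₁, h1⟩ := exists_isLeastMajorized_eq_sub_one hp hi hs hF
    obtain ⟨m₂, hm₂, h2⟩ := exists_isLeastMajorized_eq hp hi hs
    have h3 := (h m₁ hm₁).2 s
    have h4 := (h m₂ hm₂).2 s
    -- The values `β_i - 1` and `β_i` bound `π s` by `2β_i - 1` from above and from below.
    omega
  have hfixed : ∀ s ∈ fixedPart p i, 2 * essValue p i - 1 ≤ π s ∧ π s ≤ 2 * essValue p i + 1 := by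
    intro s hs
    have := (h m hm).2 s
    rwa [hm.eq_essValue hp hi hs] at this
  refine ⟨fun s hs => hunfixed s (Finset.mem_sdiff.1 hs).1 (Finset.mem_sdiff.1 hs).2, hfixed, ?_⟩
  rintro s t ⟨hs, ht, -, harc⟩
  by_contra! hlt
  -- The level set at `π t` omits `s`; non-fixed elements of `S_i` are also omitted, having
  -- `π`-value `2β_i - 1 ≤ π s < π t`.
  refine harc ⟨(Finset.univ.filter fun x => π t ≤ π x) ∩ canonPart p i,
    (hm.mem_tightFamily_iff hp hi).2 ⟨Finset.inter_subset_right,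
      hm.isTight_inter_union hp hi ((h m hm).1 _), fun x hx => ?_⟩, ?_, ?_⟩
  · rw [Finset.mem_inter, Finset.mem_filter] at hx
    by_cases hxF : x ∈ fixedPart p i
    · exact hm.eq_essValue hp hi hxF
    · have h1 := hunfixed x hx.2 hxF
      have h2 := (hfixed s hs).1
      omega
  · simp [fixedPart_subset_canonPart ht]
  · simp [hlt]

/-- The vector that is `2 β_i - 1` on the `i`-th part. -/
theorem exists_canonDual_least (hp : IsSupermodular p) :
    ∃ π : S → ℤ, (∀ i < numParts p, ∀ s ∈ canonPart p i, π s = 2 * essValue p i - 1) ∧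
      IsCanonDual p π := by
  choose idx hidx hmem using exists_mem_canonPart hp
  have hval : ∀ i < numParts p, ∀ s ∈ canonPart p i,
      2 * essValue p (idx s) - 1 = 2 * essValue p i - 1 := by
    intro i _ s hs
    rw [canonPart_index_unique (hmem s) hs]
  refine ⟨fun s => 2 * essValue p (idx s) - 1, hval, fun i hi => ⟨fun s hs => ?_, fun s hs => ?_, ?_⟩⟩
  · exact hval i hi s (Finset.mem_sdiff.1 hs).1
  · have := hval i hi s (fixedPart_subset_canonPart hs)
    simp only
    omega
  · rintro s t ⟨hs, ht, -⟩
    simp only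
    rw [hval i hi s (fixedPart_subset_canonPart hs), hval i hi t (fixedPart_subset_canonPart ht)]

/-- Strong duality enters here: the explicit canonical dual attains the weak duality bound of every
least majorized `m`, so an optimal `π` does too. -/
theorem mem_dualOptima_iff (hp : IsSupermodular p) : π ∈ dualOptima p ↔ IsCanonDual p π := by
  constructor
  · intro h
    obtain ⟨π₀, -, hπ₀⟩ := exists_canonDual_least hp
    refine isCanonDual_of_forall hp fun m hm => ?_
    have h1 := dualObjective_le_and_eq_iff hp hm.1 π
    refine h1.2.1 (le_antisymm h1.1 ?_)
    rw [← hπ₀.dualObjective_eq hp hm]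
    exact h π₀
  · intro h π'
    obtain ⟨m, hm⟩ := exists_isLeastMajorized hp
    rw [h.dualObjective_eq hp hm]
    exact (dualObjective_le_and_eq_iff hp hm.1 π').1

theorem isLNatConvex_dualOptima (hp : IsSupermodular p) : IsLNatConvex (dualOptima p) := by
  classical
  obtain ⟨π₀, -, hπ₀⟩ := exists_canonDual_least hp
  choose idx hidx hmem using exists_mem_canonPart hp
  have huniq : ∀ {i s}, s ∈ canonPart p i → idx s = i := fun hs =>
    canonPart_index_unique (hmem _) hs
  refine ⟨⟨π₀, (mem_dualOptima_iff hp).2 hπ₀⟩, fun s => ((2 * essValue p (idx s) - 1 : ℤ) :),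
    fun s => ((if s ∈ fixedPart p (idx s) then 2 * essValue p (idx s) + 1
      else 2 * essValue p (idx s) - 1 : ℤ) :),
    fun s t => if ∃ i < numParts p, IsArc p i s t then ((0 : ℤ) :) else ⊤, ?_⟩
  ext π
  rw [mem_dualOptima_iff hp, Set.mem_ofPred_eq]
  simp only [WithBot.coe_le_coe, WithTop.coe_le_coe]
  constructor
  · intro h
    refine ⟨fun s => ?_, fun s t => ?_⟩
    · have h1 := h.bounds (hidx s) (hmem s)
      refine ⟨h1.1, ?_⟩
      split_ifs with hF
      · exact h1.2
      · exact ((h _ (hidx s)).1 s (Finset.mem_sdiff.2 ⟨hmem s, hF⟩)).le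
    · split_ifs with harc
      · obtain ⟨i, hi, harc⟩ := harc
        have := (h i hi).2.2 s t harc
        rw [WithTop.coe_le_coe]
        omega
      · exact le_top
  · rintro ⟨hbox, hdiff⟩ i hi
    refine ⟨fun s hs => ?_, fun s hs => ?_, fun s t harc => ?_⟩
    · rw [Finset.mem_sdiff] at hs
      have := hbox s
      rw [huniq hs.1, if_neg hs.2] at this
      omega
    · have := hbox s
      rwa [huniq (fixedPart_subset_canonPart hs), if_pos hs] at this
    · have := hdiff s t
      rw [if_pos ⟨i, hi, harc⟩, WithTop.coe_le_coe] at this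
      omega

end Optima

end SupermodularDual

theorem theorem6p11 {S : Type*} [Fintype S] [DecidableEq S] [Nonempty S]
    (p : Finset S → WithBot ℤ) (hp : IsSupermodular p) :
    -- the canonical parts form a partition of `S`, the essential value-sequence is decreasing
    ((∀ i < numParts p, (canonPart p i).Nonempty) ∧
      (∀ i < numParts p, ∀ j < numParts p, i < j →
        Disjoint (canonPart p i) (canonPart p j) ∧ essValue p j < essValue p i) ∧
      (∀ s : S, ∃ i < numParts p, s ∈ canonPart p i)) ∧
    -- `F_i` is the set of the value-fixed elements of the `i`-th part
    (∀ i < numParts p, ∀ s : S, s ∈ fixedPart p i ↔ s ∈ canonPart p i ∧ IsValueFixed p s) ∧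
    -- the description of the optimal duals
    (∀ π : S → ℤ, π ∈ dualOptima p ↔
      ∀ i < numParts p,
        (∀ s ∈ canonPart p i \ fixedPart p i, π s = 2 * essValue p i - 1) ∧
        (∀ s ∈ fixedPart p i, 2 * essValue p i - 1 ≤ π s ∧ π s ≤ 2 * essValue p i + 1) ∧
        (∀ s t : S, IsArc p i s t → π t ≤ π s)) ∧
    -- the set of dual optima is L♮-convex, and its smallest element is `2 β_i - 1` on each part
    IsLNatConvex (dualOptima p) ∧
    ∃ πstar : S → ℤ, (∀ i < numParts p, ∀ s ∈ canonPart p i, πstar s = 2 * essValue p i - 1) ∧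
      IsLeast (dualOptima p) πstar := by
  open SupermodularDual in
  obtain ⟨π₀, hval, hπ₀⟩ := exists_canonDual_least hp
  refine ⟨⟨fun i hi => ?_, fun i _ j hj hij => ?_, exists_mem_canonPart hp⟩,
    fun i hi s => mem_fixedPart_iff_isValueFixed hp hi s, fun π => mem_dualOptima_iff hp,
    isLNatConvex_dualOptima hp, π₀, hval, (mem_dualOptima_iff hp).2 hπ₀, fun π hπ s => ?_⟩
  · exact peakAt_nonempty hp (canonChain_ne_bot hp i) (canonChain_ne_univ hi)
  · exact ⟨disjoint_canonPart hij, essValue_lt hp hij hj⟩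
  · obtain ⟨i, hi, hs⟩ := exists_mem_canonPart hp s
    rw [hval i hi s hs]
    exact (((mem_dualOptima_iff hp).1 hπ).bounds hi hs).1
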